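/- Let $\Omega=(a,b)$, $T>0$, $0<\alpha\le 1$, $\nu\ge 0$, $\mu>0$, and let $1<\sigma_1<\sigma_2<\cdots$ be real numbers. Write $(u,v)=\int_\Omega uv\,dx$ and $\|u\|=(u,u)^{1/2}$. Let $m_1,m_2,m_3\ge 0$ be integers with $\sigma_{m_1}\le 3$, $\sigma_{m_2}\le 4$, $\sigma_{m_3}\le 4$ (a condition with $m_i=0$ is void). Weights. Let $\omega_k=(-1)^k\binom{\alpha}{k}$, $g_0=\frac{2+\alpha}{2}\omega_0$ and $g_k=\frac{2+\alpha}{2}\omega_k-\frac{\alpha}{2}\omega_{k-1}$ for $k\ge1$. Let the starting weights $u_{n,k}$ ($1\le k\le m_1$), $v_{n,k}$ ($1\le k\le m_2$), $w_{n,k}$ ($1\le k\le m_3$) be real numbers, independent of the time step, that satisfy $$\sum_{k=1}^{m_1}u_{n,k}k^{\sigma_r}=\tfrac{\sigma_r}{2}\big((n+1)^{\sigma_r-1}+n^{\sigma_r-1}\big)-\big((n+1)^{\sigma_r}-n^{\sigma_r}\big),\quad 1\le r\le m_1,\ n\ge 0,$$ $$\sum_{k=1}^{m_2}v_{n,k}k^{\sigma_r-1}=\tfrac{\sigma_r-1}{2}\big((n+1)^{\sigma_r-2}+n^{\sigma_r-2}\big)-\big((n+1)^{\sigma_r-1}-n^{\sigma_r-1}\big),\quad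 1\le r\le m_2,\ n\ge1,$$ $$\sum_{k=1}^{m_3}w_{n,k}k^{\sigma_r-1}=\frac{\Gamma(\sigma_r)}{\Gamma(\sigma_r-\alpha)}n^{\sigma_r-1-\alpha}-\sum_{k=0}^n g_{n-k}k^{\sigma_r-1},\quad 1\le r\le m_3,\ n\ge1,$$ while $v_{0,k}$ and $w_{0,k}$ are arbitrary real numbers. Mesh. Let $a=x_0<\dots<x_M=b$ be a partition of $\Omega$ and $N=(N_1,\dots,N_M)$ with integers $N_i\ge1$. Let $V_N$ be the space of continuous functions on $[a,b]$ that are polynomials of degree at most $N_i$ on $(x_{i-1},x_i)$ for each $i$, and let $V_N^0=V_N\cap H_0^1(\Omega)$. Let $P_N^{1,0}:H^1_0(\Omega)\to V_N^0$ be the projection with $(\partial_x(P_N^{1,0}\phi-\phi),\partial_xv)=0$ for all $v\in V_N^0$, and let $I_N:C(\overline\Omega)\to V_N$ be the interpolation operator at the $N_i+1$ Legendre--Gauss--Lobatto points of each $[x_{i-1},x_i]$. Scheme. Let $n_T\ge 1$ be an integer with $n_T\ge m_1,m_2,m_3$, and let $\tau=T/n_T$, $t_n=n\tau$. For a sequence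 $(z^n)$ put $z^{n+1/2}=\frac{z^{n+1}+z^n}{2}$, $\delta_tz^{n+1/2}=\frac{z^{n+1}-z^n}{\tau}$ and $\mathcal A^{n}z=\tau^{-\alpha}\big(\sum_{k=0}^n g_{n-k}z^k+\sum_{k=1}^{m_3}w_{n,k}z^k\big)$. Let $\phi_0,\psi_0\in H_0^1(\Omega)$, let $f(\cdot,t)\in C(\overline\Omega)$ for every $t\in[0,T]$, and let $f^n=f(\cdot,t_n)$. Suppose that $u_N^n,v_N^n\in V_N^0$ ($0\le n\le n_T$) satisfy $u_N^0=P_N^{1,0}\phi_0$, $v_N^0=P_N^{1,0}\psi_0$ and, for $n=0,\dots,n_T-1$ and all $u,v\in V_N^0$, with $\hat v_N^k=v_N^k-v_N^0$, $$(\delta_tv_N^{n+\frac12},v)+\frac1\tau\sum_{r=1}^{m_2}v_{n,r}(v_N^r-v_N^0,v)+\frac{\nu}{2}\Big[(\mathcal A^{n+1}\hat v_N,v)+(\mathcal A^{n}\hat v_N,v)\Big]+\mu(\partial_xu_N^{n+\frac12},\partial_xv)=(I_Nf^{n+\frac12},v),$$ $$(\delta_t\partial_xu_N^{n+\frac12},\partial_xu)+\frac1\tau\sum_{r=1}^{m_1}u_{n,r}(\partial_x(u_N^r-u_N^0-t_rv_N^0),\partial_xu)=(\partial_xv_N^{n+\frac12},\partial_xu).$$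 Theorem. There is a constant $C>0$, depending only on $a,b,T,\alpha,\nu,\mu$, on $(\sigma_r)$, on $m_1,m_2,m_3$ and on the starting weights (in particular independent of $n$, $\tau$, $N$, the partition, $f$, $\phi_0$ and $\psi_0$), such that for $0\le n\le n_T$ $$\|v_N^n\|^2+\mu\|\partial_xu_N^n\|^2\le C\Big(\|v_N^0\|^2+\mu\|\partial_xu_N^0\|^2+\|\partial_xv_N^0\|^2+\sum_{r=1}^{m_1}\|\partial_x\delta_tu_N^{r-\frac12}\|^2+\sum_{r=1}^{m_2}\|\delta_tv_N^{r-\frac12}\|^2+\sum_{r=1}^{m_3}\|\delta_tv_N^{r-\frac12}\|^2+\tau\sum_{k=0}^n\|I_Nf^k\|^2\Big).$$ -/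

import Mathlib

open scoped BigOperators

noncomputable section

namespace LGSEM

/-! ### Weights in time -/

/-- `ω_k = (-1)^k * binom(α, k)`, the Grünwald–Letnikov coefficients. -/
def omega (α : ℝ) (k : ℕ) : ℝ := (-1) ^ k * Ring.choose α k

/-- The weights of the second-order weighted and shifted Grünwald–Letnikov formula with shifts
`(p, q) = (0, -1)`. -/
def gWeight (α : ℝ) : ℕ → ℝ
  | 0 => (2 + α) / 2 * omega α 0
  | k + 1 => (2 + α) / 2 * omega α (k + 1) - α / 2 * omega α k

/-- Starting weights `u_{n,k}`, `1 ≤ k ≤ m`, making the corrected averaged first difference exact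
for `t ^ σ_r`, `1 ≤ r ≤ m`. -/
def IsStartingWeightU (σ : ℕ → ℝ) (m : ℕ) (w : ℕ → ℕ → ℝ) : Prop :=
  ∀ n : ℕ, ∀ r ∈ Finset.Icc 1 m,
    ∑ k ∈ Finset.Icc 1 m, w n k * (k : ℝ) ^ σ r =
      σ r / 2 * (((n : ℝ) + 1) ^ (σ r - 1) + (n : ℝ) ^ (σ r - 1))
        - (((n : ℝ) + 1) ^ σ r - (n : ℝ) ^ σ r)

/-- Starting weights `v_{n,k}`, `1 ≤ k ≤ m`, making the corrected averaged first difference exact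
for `t ^ (σ_r - 1)`, `1 ≤ r ≤ m`. For `n = 0` the system involves `0 ^ (σ_r - 2)`, which need not
be finite, so no condition is put on the values `w 0 k`. -/
def IsStartingWeightV (σ : ℕ → ℝ) (m : ℕ) (w : ℕ → ℕ → ℝ) : Prop :=
  ∀ n : ℕ, 1 ≤ n → ∀ r ∈ Finset.Icc 1 m,
    ∑ k ∈ Finset.Icc 1 m, w n k * (k : ℝ) ^ (σ r - 1) =
      (σ r - 1) / 2 * (((n : ℝ) + 1) ^ (σ r - 2) + (n : ℝ) ^ (σ r - 2))
        - (((n : ℝ) + 1) ^ (σ r - 1) - (n : ℝ) ^ (σ r - 1))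

/-- Starting weights `w_{n,k}^{(α)}`, `1 ≤ k ≤ m`, making the corrected WSGL formula exact for
`t ^ (σ_r - 1)`, `1 ≤ r ≤ m`. For `n = 0` the system involves `0 ^ (σ_r - 1 - α)`, which need not
be finite, so no condition is put on the values `w 0 k`. -/
def IsStartingWeightW (α : ℝ) (σ : ℕ → ℝ) (m : ℕ) (w : ℕ → ℕ → ℝ) : Prop :=
  ∀ n : ℕ, 1 ≤ n → ∀ r ∈ Finset.Icc 1 m,
    ∑ k ∈ Finset.Icc 1 m, w n k * (k : ℝ) ^ (σ r - 1) =
      Real.Gamma (σ r) / Real.Gamma (σ r - α) * (n : ℝ) ^ (σ r - 1 - α)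
        - ∑ k ∈ Finset.range (n + 1), gWeight α (n - k) * (k : ℝ) ^ (σ r - 1)

/-! ### Difference operators acting on sequences of functions of `x` -/

/-- `δ_t U^{n+1/2} = (U^{n+1} - U^n) / τ`. -/
def diffQ (τ : ℝ) (U : ℕ → ℝ → ℝ) (n : ℕ) : ℝ → ℝ := fun x => (U (n + 1) x - U n x) / τ

/-- `U^{n+1/2} = (U^{n+1} + U^n) / 2`. -/
def avg (U : ℕ → ℝ → ℝ) (n : ℕ) : ℝ → ℝ := fun x => (U (n + 1) x + U n x) / 2

/-- The WSGL formula with `m` correction terms at time level `n`. -/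
def corrWSGL (α τ : ℝ) (w : ℕ → ℕ → ℝ) (m n : ℕ) (V : ℕ → ℝ → ℝ) : ℝ → ℝ := fun x =>
  1 / τ ^ α * ∑ k ∈ Finset.range (n + 1), gWeight α (n - k) * V k x
    + 1 / τ ^ α * ∑ k ∈ Finset.Icc 1 m, w n k * V k x

/-! ### Spaces in the variable `x` -/

/-- The inner product of `L²(a, b)`. -/
def ip (a b : ℝ) (u v : ℝ → ℝ) : ℝ := ∫ x in a..b, u x * v x

/-- The norm of `L²(a, b)`. -/
def l2norm (a b : ℝ) (u : ℝ → ℝ) : ℝ := Real.sqrt (∫ x in a..b, |u x| ^ 2)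

/-- `H₀¹(a, b)`: primitives of square integrable functions that vanish at both ends. Such a
function has its weak derivative almost everywhere as its classical derivative `deriv`. -/
def H10 (a b : ℝ) : Set (ℝ → ℝ) :=
  {φ | ∃ g : ℝ → ℝ,
    MeasureTheory.MemLp g 2 (MeasureTheory.volume.restrict (Set.Ioo a b)) ∧
    (∀ x ∈ Set.Icc a b, φ x = ∫ t in a..x, g t) ∧ φ b = 0}

/-- A partition `a = x_0 < x_1 < ... < x_M = b` with a polynomial degree `N_i ≥ 1` on each of its
elements; the `i`-th element, `i : Fin M`, is `(pt i.castSucc, pt i.succ)`. -/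
structure Mesh (a b : ℝ) where
  M : ℕ
  pt : Fin (M + 1) → ℝ
  strictMono : StrictMono pt
  pt_first : pt 0 = a
  pt_last : pt (Fin.last M) = b
  deg : Fin M → ℕ
  deg_pos : ∀ i, 1 ≤ deg i

variable {a b : ℝ}

/-- `V_N`: continuous functions that are polynomials of degree at most `N_i` on each element. -/
def VN (mesh : Mesh a b) : Set (ℝ → ℝ) :=
  {v | ContinuousOn v (Set.Icc a b) ∧
    ∀ i : Fin mesh.M, ∃ p : Polynomial ℝ, p.natDegree ≤ mesh.deg i ∧
      ∀ x ∈ Set.Ioo (mesh.pt i.castSucc) (mesh.pt i.succ), v x = p.eval x}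

/-- `V_N⁰ = V_N ∩ H₀¹`. -/
def VN0 (mesh : Mesh a b) : Set (ℝ → ℝ) := VN mesh ∩ H10 a b

/-- The `K + 1` Legendre–Gauss–Lobatto points of `[c, d]`: the two end points and the zeros of the
derivative of the Legendre polynomial of degree `K`, carried to `[c, d]`. Mathlib's shifted
Legendre polynomial lives on `[0, 1]`. -/
def lglPoints (c d : ℝ) (K : ℕ) : Finset ℝ :=
  {c, d} ∪ (((Polynomial.shiftedLegendre K).map (Int.castRingHom ℝ)).derivative.roots.toFinset.image
    (fun ξ => c + (d - c) * ξ))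

/-- The polynomial interpolating `u` at the Legendre–Gauss–Lobatto points of the `i`-th element. -/
def localInterp (mesh : Mesh a b) (u : ℝ → ℝ) (i : Fin mesh.M) : Polynomial ℝ :=
  Lagrange.interpolate (lglPoints (mesh.pt i.castSucc) (mesh.pt i.succ) (mesh.deg i)) id u

/-- The Legendre–Gauss–Lobatto interpolation operator `I_N`, as a function on `[a, b]`. The elements
are taken half-open so that each point of `(a, b]` is used once; `a` is itself a node. -/
def interp (mesh : Mesh a b) (u : ℝ → ℝ) : ℝ → ℝ := fun x =>
  Set.indicator {a} u x
    + ∑ i : Fin mesh.M, Set.indicator (Set.Ioc (mesh.pt i.castSucc) (mesh.pt i.succ))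
        (fun y => (localInterp mesh u i).eval y) x

/-- `p = P_N^{1,0} φ`, the projection of `φ` onto `V_N⁰` in the `H₀¹` inner product. -/
def IsProj (mesh : Mesh a b) (φ p : ℝ → ℝ) : Prop :=
  p ∈ VN0 mesh ∧
    ∀ v ∈ VN0 mesh, ip a b (fun x => deriv p x - deriv φ x) (deriv v) = 0

/-- `(u^n, v^n)`, `n = 0, ..., nT`, solve the Legendre Galerkin spectral element scheme with step
`τ`, starting weights `uw`, `vw`, `ww`, source `f x t` and initial data `φ₀`, `ψ₀`. -/
structure IsSchemeSolution (mesh : Mesh a b) (α ν μ τ : ℝ) (nT m₁ m₂ m₃ : ℕ)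
    (uw vw ww : ℕ → ℕ → ℝ) (f : ℝ → ℝ → ℝ) (φ₀ ψ₀ : ℝ → ℝ) (u v : ℕ → ℝ → ℝ) : Prop where
  mem_u : ∀ n ≤ nT, u n ∈ VN0 mesh
  mem_v : ∀ n ≤ nT, v n ∈ VN0 mesh
  eq_v : ∀ n < nT, ∀ w ∈ VN0 mesh,
    ip a b (diffQ τ v n) w
      + 1 / τ * ∑ r ∈ Finset.Icc 1 m₂, vw n r * ip a b (fun x => v r x - v 0 x) w
      + ν / 2 * (ip a b (corrWSGL α τ ww m₃ (n + 1) (fun k x => v k x - v 0 x)) w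
          + ip a b (corrWSGL α τ ww m₃ n (fun k x => v k x - v 0 x)) w)
      + μ * ip a b (deriv (avg u n)) (deriv w)
    = ip a b (interp mesh (avg (fun k x => f x (k * τ)) n)) w
  eq_u : ∀ n < nT, ∀ w ∈ VN0 mesh,
    ip a b (deriv (diffQ τ u n)) (deriv w)
      + 1 / τ * ∑ r ∈ Finset.Icc 1 m₁,
          uw n r * ip a b (deriv (fun x => u r x - u 0 x - (r * τ) * v 0 x)) (deriv w)
    = ip a b (deriv (avg v n)) (deriv w)
  init_u : IsProj mesh φ₀ (u 0)
  init_v : IsProj mesh ψ₀ (v 0)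

end LGSEM

end

noncomputable section

namespace LGSEM

open Finset Filter Topology

/-! ### Binomial weights -/

/-! The bound is an energy estimate. The first equation is tested with `v^{n+1/2} - v^0`, the second
with `μ u^{n+1/2}`. The coupling terms cancel except for `μ (∂ₓv^0, ∂ₓu^{n+1/2})`, which is how
`‖∂ₓv^0‖` enters the bound, and the difference quotients become increments of `‖v^n - v^0‖² +
μ‖∂ₓu^n‖²`. Because `v^0 - v^0 = 0`, the WSGL sums at levels `n` and `n+1` add up to twice the
convolution of `g` with the very midpoints used as test functions. Summed over `n`, this is
nonnegative (`sum_inner_gWeight_nonneg`) and can be dropped. At the level where the energy attains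
its maximum `M` this gives `M ≤ e_0 + 2 √M R` with `R` made of data, so no Gronwall argument is
needed (`TestedScheme.stability`).

Positivity. The generating function of `g` is `(1-z)^α (1 + α/2 (1-z))`. For `α < 1` the power
`(1-z)^α` is, up to a positive constant, an integral of `u(1-z)/(1-uz)` over `0 < u < 1` against a
positive density. For each `u` the quadratic form is controlled by a telescoping inequality like
that of BDF2; `α = 1` is treated directly.

Starting weights. `v^r - v^0` is `τ` times a sum of difference quotients, and likewise for `u`. So
it suffices that `u_{n,k}` and `v_{n,k}` are bounded and that `w_{n,k} = O(n^{1-α})`, since `τ^{-α}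
τ n^{1-α} = (nτ)^{1-α} ≤ T^{1-α}`. The matrices of the defining systems do not depend on `n` and are
invertible (`rpow_sum_eq_zero`), so the right-hand sides decide. Two of them are trapezoidal errors
for powers of exponent at most 3. The third is the defect of the WSGL formula on `k^β`, `β ≤ 3`
(`isBigO_consistency`): `k^β` is expanded in binomial sequences, whose convolution with `g` is
explicit, up to a bounded remainder. -/

lemma omega_zero (x : ℝ) : omega x 0 = 1 := by simp [omega]

lemma omega_succ_succ (x : ℝ) (k : ℕ) :
    omega (x + 1) (k + 1) = omega x (k + 1) - omega x k := by
  unfold omega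
  rw [Ring.choose_succ_succ]
  ring

lemma omega_succ (x : ℝ) (k : ℕ) :
    ((k : ℝ) + 1) * omega x (k + 1) = ((k : ℝ) - x) * omega x k := by
  have h := Ring.choose_smul_choose x (n := k + 1) (k := k) (by omega)
  simp only [nsmul_eq_mul, Nat.add_sub_cancel_left, Ring.choose_one_right] at h
  unfold omega
  rw [Nat.choose_succ_self_right] at h
  push_cast at h
  rw [pow_succ]
  linear_combination (-(-1 : ℝ) ^ k) * h

lemma omega_succ_eq (x : ℝ) (k : ℕ) :
    omega x (k + 1) = ((k : ℝ) - x) / ((k : ℝ) + 1) * omega x k := by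
  have := omega_succ x k
  have : (k : ℝ) + 1 ≠ 0 := by positivity
  field_simp
  linarith

/-- Chu–Vandermonde: `omega x` is the coefficient sequence of `(1-z)^x`, and exponents add under
multiplication. -/
lemma omega_conv (x y : ℝ) (n : ℕ) :
    ∑ k ∈ range (n + 1), omega x (n - k) * omega y k = omega (x + y) n := by
  unfold omega
  rw [add_comm x y, Ring.add_choose_eq n (Commute.all y x),
    Nat.sum_antidiagonal_eq_sum_range_succ_mk, Finset.mul_sum]
  refine Finset.sum_congr rfl fun k hk => ?_
  have hk' : k ≤ n := by simpa [Nat.lt_succ_iff] using hk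
  have : (-1 : ℝ) ^ n = (-1) ^ (n - k) * (-1) ^ k := by
    rw [← pow_add, Nat.sub_add_cancel hk']
  rw [this]
  ring

/-- The generating function is `(1-z)^α + α/2 (1-z)^(α+1)`. In this form `omega_conv` evaluates
convolutions with any `omega y`. -/
lemma gWeight_eq (α : ℝ) (k : ℕ) : gWeight α k = omega α k + α / 2 * omega (α + 1) k := by
  cases k with
  | zero => simp [gWeight, omega_zero]; ring
  | succ k => simp only [gWeight, omega_succ_succ]; ring

lemma gWeight_conv (α y : ℝ) (n : ℕ) :
    ∑ k ∈ range (n + 1), gWeight α (n - k) * omega y k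
      = omega (α + y) n + α / 2 * omega (α + 1 + y) n := by
  simp only [gWeight_eq, add_mul, Finset.sum_add_distrib, omega_conv, mul_assoc,
    ← Finset.mul_sum]

lemma omega_pos {x : ℝ} (hx : x < 0) (n : ℕ) : 0 < omega x n := by
  induction n with
  | zero => simp [omega_zero]
  | succ n ih =>
    rw [omega_succ_eq]
    have : 0 < (n : ℝ) - x := by have := n.cast_nonneg (α := ℝ); linarith
    positivity

lemma omega_nonneg {x : ℝ} (hx : x ≤ 0) (n : ℕ) : 0 ≤ omega x n := by
  induction n with
  | zero => simp [omega_zero]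
  | succ n ih =>
    rw [omega_succ_eq]
    have : 0 ≤ (n : ℝ) - x := by have := n.cast_nonneg (α := ℝ); linarith
    positivity

lemma omega_succ_nonpos {x : ℝ} (h0 : 0 ≤ x) (h1 : x ≤ 1) (n : ℕ) : omega x (n + 1) ≤ 0 := by
  induction n with
  | zero => rw [omega_succ_eq]; simp [omega_zero]; linarith
  | succ n ih =>
    rw [omega_succ_eq]
    have : 0 ≤ ((n + 1 : ℕ) : ℝ) - x := by
      have := n.cast_nonneg (α := ℝ); push_cast; linarith
    exact mul_nonpos_of_nonneg_of_nonpos (by positivity) ih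

lemma abs_omega_le_one {x : ℝ} (h0 : -1 ≤ x) (h1 : x ≤ 1) (n : ℕ) : |omega x n| ≤ 1 := by
  induction n with
  | zero => simp [omega_zero]
  | succ n ih =>
    rw [omega_succ_eq, abs_mul, abs_div]
    have hn := n.cast_nonneg (α := ℝ)
    have h2 : |(n : ℝ) - x| ≤ |(n : ℝ) + 1| := by
      rw [abs_of_nonneg (a := (n : ℝ) + 1) (by positivity), abs_le]
      constructor <;> linarith
    have h3 : |(n : ℝ) - x| / |(n : ℝ) + 1| ≤ 1 := div_le_one_of_le₀ h2 (abs_nonneg _)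
    calc _ ≤ 1 * 1 := mul_le_mul h3 ih (abs_nonneg _) zero_le_one
      _ = 1 := one_mul 1

lemma omega_neg_one (n : ℕ) : omega (-1) n = 1 := by
  induction n with
  | zero => exact omega_zero _
  | succ n ih =>
    rw [omega_succ_eq, ih]
    have : (n : ℝ) + 1 ≠ 0 := by positivity
    field_simp
    ring

lemma sum_omega (x : ℝ) (n : ℕ) : ∑ k ∈ range (n + 1), omega x k = omega (x - 1) n := by
  have h := omega_conv (-1) x n
  simp only [omega_neg_one, one_mul] at h
  rw [h]; ring_nf

/-- Only the zeroth coefficient, which is 1, is positive. The signed partial sums are coefficients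
of `(1-z)^(x-1)`, hence nonnegative, so the negative part has mass at most 1. -/
lemma sum_abs_omega_le {x : ℝ} (h0 : 0 ≤ x) (h1 : x ≤ 1) (n : ℕ) :
    ∑ k ∈ range (n + 1), |omega x k| ≤ 2 := by
  have h := sum_omega x n
  have hp := omega_nonneg (x := x - 1) (by linarith) n
  have h2 : ∑ k ∈ range (n + 1), |omega x k| = 2 - ∑ k ∈ range (n + 1), omega x k := by
    rw [Finset.sum_range_succ', Finset.sum_range_succ' (fun k => omega x k), omega_zero,
      Finset.sum_congr rfl fun k _ => abs_of_nonpos (omega_succ_nonpos h0 h1 k),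
      Finset.sum_neg_distrib]
    norm_num
    ring
  linarith

lemma sum_abs_gWeight_le {α : ℝ} (h0 : 0 ≤ α) (h1 : α ≤ 1) (n : ℕ) :
    ∑ k ∈ range (n + 1), |gWeight α (n - k)| ≤ 4 := by
  have hs := Finset.sum_range_reflect (fun k => |gWeight α k|) (n + 1)
  simp only [Nat.add_sub_cancel] at hs
  rw [hs, Finset.sum_range_succ']
  have hb := sum_abs_omega_le h0 h1 n
  have hb' := sum_abs_omega_le h0 h1 (n - 1)
  have hk : ∀ k, |gWeight α (k + 1)| ≤ (2 + α) / 2 * |omega α (k + 1)| + α / 2 * |omega α k| := by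
    intro k
    simp only [gWeight]
    refine (abs_sub _ _).trans (le_of_eq ?_)
    rw [abs_mul, abs_mul, abs_of_nonneg (show 0 ≤ (2 + α) / 2 by linarith),
      abs_of_nonneg (show 0 ≤ α / 2 by linarith)]
  have h00 : |gWeight α 0| = (2 + α) / 2 * |omega α 0| := by
    simp only [gWeight]
    rw [abs_mul, abs_of_nonneg (show 0 ≤ (2 + α) / 2 by linarith)]
  have h3 : ∑ k ∈ range n, |omega α k| ≤ 2 := by
    refine le_trans ?_ hb
    rw [Finset.sum_range_succ]
    linarith [abs_nonneg (omega α n)]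
  calc _ ≤ ∑ k ∈ range n, ((2 + α) / 2 * |omega α (k + 1)| + α / 2 * |omega α k|)
        + (2 + α) / 2 * |omega α 0| := by
        rw [h00]; gcongr with k; exact hk k
    _ = (2 + α) / 2 * ∑ k ∈ range (n + 1), |omega α k| + α / 2 * ∑ k ∈ range n, |omega α k| := by
        rw [Finset.sum_range_succ', Finset.sum_add_distrib, ← Finset.mul_sum, ← Finset.mul_sum]
        ring
    _ ≤ (2 + α) / 2 * 2 + α / 2 * 2 := by gcongr
    _ ≤ 4 := by linarith

/-! ### Asymptotics of the weights -/

lemma omega_eq_prod (γ : ℝ) (n : ℕ) :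
    omega (-γ - 1) n * n.factorial = ∏ j ∈ range n, (γ + 1 + j) := by
  induction n with
  | zero => simp [omega_zero]
  | succ n ih =>
    rw [Finset.prod_range_succ, ← ih, Nat.factorial_succ]
    push_cast
    linear_combination (n.factorial : ℝ) * omega_succ (-γ - 1) n

/-- Euler's limit formula for `Γ(γ+1)`. Its product has one more factor, `γ+1+n`, than the one in
`omega_eq_prod`, and `(γ+1+n)/n` tends to 1. -/
lemma tendsto_rpow_div_omega {γ : ℝ} (hγ : -1 < γ) :
    Tendsto (fun n : ℕ => (n : ℝ) ^ γ / omega (-γ - 1) n) atTop (𝓝 (Real.Gamma (γ + 1))) := by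
  have h1 := Real.GammaSeq_tendsto_Gamma (γ + 1)
  have h2 : Tendsto (fun n : ℕ => 1 + (γ + 1) / (n : ℝ)) atTop (𝓝 (1 + 0)) :=
    (tendsto_const_div_atTop_nhds_zero_nat (γ + 1)).const_add 1
  have h3 := h1.mul h2
  rw [add_zero, mul_one] at h3
  refine h3.congr' ?_
  filter_upwards [eventually_ge_atTop 1] with n hn
  have hn0 : (0 : ℝ) < n := by exact_mod_cast hn
  have ha := omega_pos (x := -γ - 1) (by linarith) n
  unfold Real.GammaSeq
  rw [Finset.prod_range_succ, ← omega_eq_prod, Real.rpow_add_one hn0.ne']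
  have : (0 : ℝ) < n.factorial := by exact_mod_cast n.factorial_pos
  have : γ + 1 + n ≠ 0 := by linarith
  field_simp
  ring

lemma exists_omega_bounds {γ : ℝ} (hγ : -1 < γ) :
    ∃ c C : ℝ, 0 < c ∧ 0 < C ∧ ∀ n : ℕ, 1 ≤ n →
      c * (n : ℝ) ^ γ ≤ omega (-γ - 1) n ∧ omega (-γ - 1) n ≤ C * (n : ℝ) ^ γ := by
  have hG : 0 < Real.Gamma (γ + 1) := Real.Gamma_pos_of_pos (by linarith)
  have h := tendsto_rpow_div_omega hγ
  have h' := h.inv₀ hG.ne'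
  obtain ⟨B, hB⟩ := h.bddAbove_range
  obtain ⟨B', hB'⟩ := h'.bddAbove_range
  have hpos : ∀ n : ℕ, 0 < omega (-γ - 1) n := omega_pos (by linarith)
  have key : ∀ n : ℕ, 1 ≤ n → (n : ℝ) ^ γ / omega (-γ - 1) n ≤ max B 1 ∧
      ((n : ℝ) ^ γ / omega (-γ - 1) n)⁻¹ ≤ max B' 1 := fun n _ =>
    ⟨(hB ⟨n, rfl⟩).trans (le_max_left _ _), (hB' ⟨n, rfl⟩).trans (le_max_left _ _)⟩
  refine ⟨(max B 1)⁻¹, max B' 1, by positivity, by positivity, fun n hn => ?_⟩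
  have hn0 : (0 : ℝ) < n := by exact_mod_cast hn
  have hp : 0 < (n : ℝ) ^ γ := Real.rpow_pos_of_pos hn0 γ
  obtain ⟨k1, k2⟩ := key n hn
  rw [div_le_iff₀ (hpos n)] at k1
  rw [inv_div, div_le_iff₀ hp] at k2
  exact ⟨by rw [inv_mul_le_iff₀ (by positivity)]; exact k1, k2⟩

/-- A sequence that nearly satisfies the recurrence of `omega (-γ - 1)` is close to a multiple of
it. -/
lemma exists_abs_sub_omega_le {γ : ℝ} (hγ : -1 < γ) {J : ℕ} (hJ : 1 ≤ J) {s : ℕ → ℝ} {K K' : ℝ}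
    (hs : ∀ n : ℕ, 1 ≤ n → |((n : ℝ) + 1) * s (n + 1) - ((n : ℝ) + 1 + γ) * s n|
      ≤ K * ((n : ℝ) ^ γ / (n : ℝ) ^ J))
    (hlim : ∀ n : ℕ, 1 ≤ n → |s n - (n : ℝ) ^ γ| ≤ K' * ((n : ℝ) ^ γ / (n : ℝ))) :
    ∃ C : ℝ, ∀ n : ℕ, 1 ≤ n →
      |s n - Real.Gamma (γ + 1) * omega (-γ - 1) n| ≤ C * ((n : ℝ) ^ γ / (n : ℝ) ^ J) := by
  obtain ⟨c, C, hc, hC, hcC⟩ := exists_omega_bounds hγ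
  have hpos : ∀ n : ℕ, 0 < omega (-γ - 1) n := omega_pos (by linarith)
  set q : ℕ → ℝ := fun n => s n / omega (-γ - 1) n with hq
  have hK : 0 ≤ K := by
    have := (abs_nonneg _).trans (hs 1 le_rfl)
    simpa using this
  have hq_lim : Tendsto q atTop (𝓝 (Real.Gamma (γ + 1))) := by
    have h1 := tendsto_rpow_div_omega hγ
    -- `hlim` serves only to identify the limit of `q`; the rate comes from the increments.
    have h2 : Tendsto (fun n => q n - (n : ℝ) ^ γ / omega (-γ - 1) n) atTop (𝓝 0) := by
      refine squeeze_zero_norm' (a := fun n : ℕ => (|K'| / c) / (n : ℝ)) ?_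
        (tendsto_const_div_atTop_nhds_zero_nat _)
      filter_upwards [eventually_ge_atTop 1] with n hn
      have hn0 : (0 : ℝ) < n := by exact_mod_cast hn
      have hp : 0 < (n : ℝ) ^ γ := Real.rpow_pos_of_pos hn0 γ
      rw [hq, ← sub_div, Real.norm_eq_abs, abs_div, abs_of_pos (hpos n), div_le_iff₀ (hpos n)]
      calc _ ≤ K' * ((n : ℝ) ^ γ / (n : ℝ)) := hlim n hn
        _ ≤ |K'| * ((n : ℝ) ^ γ / (n : ℝ)) := by gcongr; exact le_abs_self _
        _ = |K'| / c / n * (c * (n : ℝ) ^ γ) := by field_simp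
        _ ≤ _ := by gcongr; exact (hcC n hn).1
    simpa using h2.add h1
  -- the increments of `q`
  have hinc : ∀ n : ℕ, 1 ≤ n → |q (n + 1) - q n| ≤ K / c / (n : ℝ) ^ (J + 1) := by
    intro n hn
    have hn0 : (0 : ℝ) < n := by exact_mod_cast hn
    have hp : 0 < (n : ℝ) ^ γ := Real.rpow_pos_of_pos hn0 γ
    have hrec : ((n : ℝ) + 1) * omega (-γ - 1) (n + 1) = ((n : ℝ) + 1 + γ) * omega (-γ - 1) n := by
      rw [omega_succ]; ring
    have hd : q (n + 1) - q n = (((n : ℝ) + 1) * s (n + 1) - ((n : ℝ) + 1 + γ) * s n)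
        / (((n : ℝ) + 1) * omega (-γ - 1) (n + 1)) := by
      have h1 := hpos n
      have h2 := hpos (n + 1)
      simp only [hq]
      rw [div_sub_div _ _ h2.ne' h1.ne', div_eq_div_iff (by positivity) (by positivity)]
      linear_combination (-(s n) * omega (-γ - 1) (n + 1)) * hrec
    have hden : (n : ℝ) * (c * (n : ℝ) ^ γ) ≤ ((n : ℝ) + 1) * omega (-γ - 1) (n + 1) := by
      rw [hrec]
      exact mul_le_mul (by linarith) (hcC n hn).1 (by positivity) (by linarith)
    rw [hd, abs_div, abs_of_pos (lt_of_lt_of_le (by positivity) hden),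
      div_le_iff₀ (lt_of_lt_of_le (by positivity) hden)]
    calc _ ≤ K * ((n : ℝ) ^ γ / (n : ℝ) ^ J) := hs n hn
      _ = K / c / (n : ℝ) ^ (J + 1) * ((n : ℝ) * (c * (n : ℝ) ^ γ)) := by
          rw [pow_succ]; field_simp
      _ ≤ _ := by gcongr
  -- The factor `2^J` pays for `(n+1)^J ≤ 2^J n^J` when `n^(-J-1)` is dominated by a multiple of the
  -- telescoping difference `n^(-J) - (n+1)^(-J)`.
  set D : ℝ := K / c * 2 ^ J with hD
  have htel : ∀ n : ℕ, 1 ≤ n →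
      K / c / (n : ℝ) ^ (J + 1) ≤ D / (n : ℝ) ^ J - D / ((n : ℝ) + 1) ^ J := by
    intro n hn
    have hn0 : (0 : ℝ) < n := by exact_mod_cast hn
    have hn1 : (1 : ℝ) ≤ n := by exact_mod_cast hn
    have hbern : (n : ℝ) ^ J * ((n : ℝ) + 1) ≤ ((n : ℝ) + 1) ^ J * n := by
      obtain ⟨i, rfl⟩ : ∃ i, J = i + 1 := ⟨J - 1, by omega⟩
      have : (n : ℝ) ^ i ≤ ((n : ℝ) + 1) ^ i := by gcongr; linarith
      calc _ = (n : ℝ) ^ i * ((n + 1) * n) := by ring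
        _ ≤ ((n : ℝ) + 1) ^ i * ((n + 1) * n) := by gcongr
        _ = _ := by ring
    have h2 : ((n : ℝ) + 1) ^ J ≤ 2 ^ J * (n : ℝ) ^ J := by
      rw [← mul_pow]; gcongr; linarith
    have h3 : 1 / (n : ℝ) ^ J - 1 / ((n : ℝ) + 1) ^ J ≥ 1 / (n * ((n : ℝ) + 1) ^ J) := by
      rw [ge_iff_le, div_sub_div _ _ (by positivity) (by positivity),
        div_le_div_iff₀ (by positivity) (by positivity)]
      have : 0 < ((n : ℝ) + 1) ^ J := by positivity
      nlinarith
    have h4 : 1 / (2 ^ J * (n : ℝ) ^ (J + 1)) ≤ 1 / (n * ((n : ℝ) + 1) ^ J) := by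
      apply one_div_le_one_div_of_le (by positivity)
      rw [pow_succ]
      nlinarith
    calc _ = D * (1 / (2 ^ J * (n : ℝ) ^ (J + 1))) := by rw [hD]; field_simp
      _ ≤ D * (1 / (n : ℝ) ^ J - 1 / ((n : ℝ) + 1) ^ J) := by gcongr; linarith
      _ = _ := by ring
  have hD0 : 0 ≤ D := by positivity
  have hdiff : ∀ n : ℕ, 1 ≤ n → ∀ k : ℕ,
      |q (n + k) - q n| ≤ D / (n : ℝ) ^ J - D / (n + k : ℝ) ^ J := by
    intro n hn k
    induction k with
    | zero => simp
    | succ k ih =>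
      have h1 := hinc (n + k) (by omega)
      have h2 := htel (n + k) (by omega)
      have h3 := abs_sub_le (q (n + k + 1)) (q (n + k)) (q n)
      push_cast at h1 h2 ⊢
      rw [← add_assoc, ← add_assoc]
      linarith
  have hfin : ∀ n : ℕ, 1 ≤ n → |q n - Real.Gamma (γ + 1)| ≤ D / (n : ℝ) ^ J := by
    intro n hn
    have hl : Tendsto (fun k : ℕ => |q n - q (k + n)|) atTop (𝓝 |q n - Real.Gamma (γ + 1)|) :=
      (((tendsto_add_atTop_iff_nat n).2 hq_lim).const_sub (q n)).abs
    refine le_of_tendsto hl (Eventually.of_forall fun k => ?_)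
    have h := hdiff n hn k
    have : 0 ≤ D / (n + k : ℝ) ^ J := by positivity
    rw [abs_sub_comm, add_comm k n]
    linarith
  refine ⟨C * D, fun n hn => ?_⟩
  have h := hfin n hn
  have hn0 : (0 : ℝ) < n := by exact_mod_cast hn
  have h1 : s n - Real.Gamma (γ + 1) * omega (-γ - 1) n
      = (q n - Real.Gamma (γ + 1)) * omega (-γ - 1) n := by
    simp only [hq]
    have := (hpos n).ne'
    field_simp
  rw [h1, abs_mul, abs_of_pos (hpos n)]
  calc _ ≤ D / (n : ℝ) ^ J * (C * (n : ℝ) ^ γ) :=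
        mul_le_mul h (hcC n hn).2 (hpos n).le (by positivity)
    _ = _ := by ring

/-! ### Taylor expansion of real powers -/

/-- One order of Taylor's formula from the mean value inequality on `[0, y]`. The derivative of a
Taylor remainder of `(1+y)^p` is `p` times the preceding remainder for `p-1`, so the lemma is
applied once per order. -/
lemma abs_le_mul_pow_succ {f f' : ℝ → ℝ} {C : ℝ} {k : ℕ} (h0 : f 0 = 0)
    (hf : ∀ y, 0 ≤ y → HasDerivAt f (f' y) y)
    (hb : ∀ y, 0 ≤ y → y ≤ 1 → |f' y| ≤ C * y ^ k) :
    ∀ y, 0 ≤ y → y ≤ 1 → |f y| ≤ C * y ^ (k + 1) := by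
  intro y hy hy1
  have h := Convex.norm_image_sub_le_of_norm_hasDerivWithin_le (f := f) (f' := f') (C := C * y ^ k)
    (s := Set.Icc 0 y) (x := 0) (y := y)
    (fun x hx => (hf x hx.1).hasDerivWithinAt) ?_ (convex_Icc 0 y) ⟨le_rfl, hy⟩ ⟨hy, le_rfl⟩
  · simpa [h0, abs_of_nonneg hy, pow_succ, mul_assoc] using h
  · intro x hx
    have hC : 0 ≤ C := by
      have := (abs_nonneg _).trans (hb 1 zero_le_one le_rfl)
      simpa using this
    refine (hb x hx.1 (hx.2.trans hy1)).trans ?_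
    have := hx.1
    have := hx.2
    gcongr

lemma hasDerivAt_one_add_rpow (p : ℝ) {y : ℝ} (hy : 0 ≤ y) :
    HasDerivAt (fun y : ℝ => (1 + y) ^ p) (p * (1 + y) ^ (p - 1)) y := by
  have h := ((hasDerivAt_id y).const_add 1).rpow_const (p := p) (Or.inl (by simp; linarith))
  simpa [mul_comm] using h

lemma exists_taylor_zero (p : ℝ) :
    ∃ C : ℝ, ∀ y : ℝ, 0 ≤ y → y ≤ 1 → |(1 + y) ^ p| ≤ C * y ^ 0 := by
  refine ⟨2 ^ |p|, fun y hy hy1 => ?_⟩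
  rw [pow_zero, mul_one, abs_of_nonneg (Real.rpow_nonneg (by linarith) _)]
  calc (1 + y) ^ p ≤ (1 + y) ^ |p| :=
        Real.rpow_le_rpow_of_exponent_le (by linarith) (le_abs_self p)
    _ ≤ _ := Real.rpow_le_rpow (by linarith) (by linarith) (abs_nonneg p)

lemma exists_taylor_one (p : ℝ) :
    ∃ C : ℝ, ∀ y : ℝ, 0 ≤ y → y ≤ 1 → |(1 + y) ^ p - 1| ≤ C * y ^ 1 := by
  obtain ⟨C, hC⟩ := exists_taylor_zero (p - 1)
  refine ⟨|p| * C, abs_le_mul_pow_succ (k := 0) (f' := fun y => p * (1 + y) ^ (p - 1)) (by simp)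
    (fun y hy => (hasDerivAt_one_add_rpow p hy).sub_const 1) fun y hy hy1 => ?_⟩
  rw [abs_mul, mul_assoc]
  exact mul_le_mul_of_nonneg_left (hC y hy hy1) (abs_nonneg p)

lemma exists_taylor_two (p : ℝ) :
    ∃ C : ℝ, ∀ y : ℝ, 0 ≤ y → y ≤ 1 → |(1 + y) ^ p - 1 - p * y| ≤ C * y ^ 2 := by
  obtain ⟨C, hC⟩ := exists_taylor_one (p - 1)
  refine ⟨|p| * C, abs_le_mul_pow_succ (k := 1)
    (f' := fun y => p * ((1 + y) ^ (p - 1) - 1)) (by simp)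
    (fun y hy => ?_) fun y hy hy1 => ?_⟩
  · refine (((hasDerivAt_one_add_rpow p hy).sub_const 1).sub
      ((hasDerivAt_id y).const_mul p)).congr_deriv ?_
    ring
  · rw [abs_mul, mul_assoc]
    exact mul_le_mul_of_nonneg_left (hC y hy hy1) (abs_nonneg p)

lemma exists_taylor_three (p : ℝ) :
    ∃ C : ℝ, ∀ y : ℝ, 0 ≤ y → y ≤ 1 →
      |(1 + y) ^ p - 1 - p * y - p * (p - 1) / 2 * y ^ 2| ≤ C * y ^ 3 := by
  obtain ⟨C, hC⟩ := exists_taylor_two (p - 1)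
  refine ⟨|p| * C, abs_le_mul_pow_succ (k := 2)
    (f' := fun y => p * ((1 + y) ^ (p - 1) - 1 - (p - 1) * y)) (by simp)
    (fun y hy => ?_) fun y hy hy1 => ?_⟩
  · refine ((((hasDerivAt_one_add_rpow p hy).sub_const 1).sub
      ((hasDerivAt_id y).const_mul p)).sub
      ((hasDerivAt_pow 2 y).const_mul (p * (p - 1) / 2))).congr_deriv ?_
    simp
    ring
  · rw [abs_mul, mul_assoc]
    exact mul_le_mul_of_nonneg_left (hC y hy hy1) (abs_nonneg p)

lemma exists_taylor_four (p : ℝ) :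
    ∃ C : ℝ, ∀ y : ℝ, 0 ≤ y → y ≤ 1 →
      |(1 + y) ^ p - 1 - p * y - p * (p - 1) / 2 * y ^ 2 - p * (p - 1) * (p - 2) / 6 * y ^ 3|
        ≤ C * y ^ 4 := by
  obtain ⟨C, hC⟩ := exists_taylor_three (p - 1)
  refine ⟨|p| * C, abs_le_mul_pow_succ (k := 3)
    (f' := fun y => p * ((1 + y) ^ (p - 1) - 1 - (p - 1) * y
      - (p - 1) * (p - 1 - 1) / 2 * y ^ 2)) (by simp)
    (fun y hy => ?_) fun y hy hy1 => ?_⟩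
  · refine (((((hasDerivAt_one_add_rpow p hy).sub_const 1).sub
      ((hasDerivAt_id y).const_mul p)).sub
      ((hasDerivAt_pow 2 y).const_mul (p * (p - 1) / 2))).sub
      ((hasDerivAt_pow 3 y).const_mul (p * (p - 1) * (p - 2) / 6))).congr_deriv ?_
    simp
    ring
  · rw [abs_mul, mul_assoc]
    exact mul_le_mul_of_nonneg_left (hC y hy hy1) (abs_nonneg p)

lemma natCast_succ_rpow (p : ℝ) {n : ℕ} (hn : 1 ≤ n) :
    ((n : ℝ) + 1) ^ p = (n : ℝ) ^ p * (1 + 1 / (n : ℝ)) ^ p := by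
  have hn0 : (0 : ℝ) < n := by exact_mod_cast hn
  rw [← Real.mul_rpow hn0.le (by positivity)]
  congr 1
  field_simp

lemma one_div_natCast_le_one {n : ℕ} (hn : 1 ≤ n) : 1 / (n : ℝ) ≤ 1 := by
  have hn1 : (1 : ℝ) ≤ n := by exact_mod_cast hn
  rw [div_le_one (by linarith)]
  exact hn1

/-- The error of the trapezoidal rule for a real power, on consecutive integers. -/
lemma exists_trapezoid_bound {p : ℝ} (hp : p ≤ 3) :
    ∃ C : ℝ, ∀ n : ℕ, 1 ≤ n →
      |p / 2 * (((n : ℝ) + 1) ^ (p - 1) + (n : ℝ) ^ (p - 1))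
        - (((n : ℝ) + 1) ^ p - (n : ℝ) ^ p)| ≤ C := by
  obtain ⟨C₁, h₁⟩ := exists_taylor_two (p - 1)
  obtain ⟨C₂, h₂⟩ := exists_taylor_three p
  refine ⟨|p / 2| * C₁ + C₂, fun n hn => ?_⟩
  have hn0 : (0 : ℝ) < n := by exact_mod_cast hn
  have hn1 : (1 : ℝ) ≤ n := by exact_mod_cast hn
  set y : ℝ := 1 / (n : ℝ) with hy
  have hy0 : 0 < y := by positivity
  have hy1 : y ≤ 1 := one_div_natCast_le_one hn
  have e1 := h₁ y hy0.le hy1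
  have e2 := h₂ y hy0.le hy1
  have hp1 : (n : ℝ) ^ (p - 1) = (n : ℝ) ^ p * y := by
    rw [Real.rpow_sub_one hn0.ne', hy]; ring
  have hpp : 0 < (n : ℝ) ^ p := Real.rpow_pos_of_pos hn0 p
  rw [natCast_succ_rpow _ hn, natCast_succ_rpow _ hn, ← hy, hp1]
  -- With `y = 1/n` the terms of order `y` and `y²` agree in both expansions. What remains is of
  -- order `n^p y³`, bounded because `p ≤ 3`.
  have hid : p / 2 * ((n : ℝ) ^ p * y * (1 + y) ^ (p - 1) + (n : ℝ) ^ p * y)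
      - ((n : ℝ) ^ p * (1 + y) ^ p - (n : ℝ) ^ p)
      = (n : ℝ) ^ p * (p / 2 * y * ((1 + y) ^ (p - 1) - 1 - (p - 1) * y)
        - ((1 + y) ^ p - 1 - p * y - p * (p - 1) / 2 * y ^ 2)) := by ring
  rw [hid, abs_mul, abs_of_pos hpp]
  have hb : |p / 2 * y * ((1 + y) ^ (p - 1) - 1 - (p - 1) * y)
        - ((1 + y) ^ p - 1 - p * y - p * (p - 1) / 2 * y ^ 2)| ≤ (|p / 2| * C₁ + C₂) * y ^ 3 := by
    refine (abs_sub _ _).trans ?_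
    rw [abs_mul, abs_mul, abs_of_pos hy0]
    calc _ ≤ |p / 2| * y * (C₁ * y ^ 2) + C₂ * y ^ 3 := by gcongr
      _ = _ := by ring
  have hC : 0 ≤ |p / 2| * C₁ + C₂ := by
    have := (abs_nonneg _).trans hb
    exact nonneg_of_mul_nonneg_left this (by positivity)
  have hle : (n : ℝ) ^ p * y ^ 3 ≤ 1 := by
    have : (n : ℝ) ^ p ≤ (n : ℝ) ^ (3 : ℝ) := Real.rpow_le_rpow_of_exponent_le hn1 hp
    rw [show (3 : ℝ) = (3 : ℕ) by norm_num, Real.rpow_natCast] at this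
    calc _ ≤ (n : ℝ) ^ 3 * y ^ 3 := by gcongr
      _ = 1 := by rw [hy]; field_simp
  calc _ ≤ (n : ℝ) ^ p * ((|p / 2| * C₁ + C₂) * y ^ 3) := by gcongr
    _ = (|p / 2| * C₁ + C₂) * ((n : ℝ) ^ p * y ^ 3) := by ring
    _ ≤ (|p / 2| * C₁ + C₂) * 1 := by gcongr
    _ = _ := mul_one _

/-! ### Expansion of powers in the weights -/

/-- The multiple of `omega (-γ - 1)` that is asymptotic to `n ^ γ`. -/
def cesaro (γ : ℝ) (n : ℕ) : ℝ := Real.Gamma (γ + 1) * omega (-γ - 1) n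

lemma cesaro_recurrence (γ : ℝ) (n : ℕ) :
    ((n : ℝ) + 1) * cesaro γ (n + 1) = ((n : ℝ) + 1 + γ) * cesaro γ n := by
  unfold cesaro
  linear_combination Real.Gamma (γ + 1) * omega_succ (-γ - 1) n

/-- The defect of `n^γ` in the recurrence of `cesaro γ`, written as a Taylor remainder so that its
expansion in powers of `1/n` can be read off. -/
lemma rpow_recurrence (γ : ℝ) {n : ℕ} (hn : 1 ≤ n) :
    ((n : ℝ) + 1) * (((n + 1 : ℕ) : ℝ)) ^ γ - ((n : ℝ) + 1 + γ) * (n : ℝ) ^ γ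
      = (n : ℝ) ^ γ * n * ((1 + 1 / (n : ℝ)) ^ (γ + 1) - 1 - (γ + 1) * (1 / (n : ℝ))) := by
  have hn0 : (0 : ℝ) < n := by exact_mod_cast hn
  push_cast
  have h1 : ((n : ℝ) + 1) * ((n : ℝ) + 1) ^ γ = ((n : ℝ) + 1) ^ (γ + 1) := by
    rw [Real.rpow_add_one (by positivity)]; ring
  rw [h1, natCast_succ_rpow _ hn, Real.rpow_add_one hn0.ne']
  field_simp
  ring

lemma exists_expansion_one {γ : ℝ} (hγ : -1 < γ) :
    ∃ C : ℝ, ∀ n : ℕ, 1 ≤ n → |(n : ℝ) ^ γ - cesaro γ n| ≤ C * ((n : ℝ) ^ γ / (n : ℝ) ^ 1) := by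
  obtain ⟨C, hC⟩ := exists_taylor_two (γ + 1)
  refine exists_abs_sub_omega_le hγ le_rfl (s := fun n => (n : ℝ) ^ γ) (K := C) (K' := 0)
    (fun n hn => ?_) (fun n hn => by simp)
  have hn0 : (0 : ℝ) < n := by exact_mod_cast hn
  rw [rpow_recurrence γ hn, abs_mul, abs_of_nonneg (by positivity)]
  calc _ ≤ (n : ℝ) ^ γ * n * (C * (1 / (n : ℝ)) ^ 2) := by
        gcongr; exact hC _ (by positivity) (one_div_natCast_le_one hn)
    _ = _ := by field_simp

lemma exists_cesaro_le {γ : ℝ} (hγ : -1 < γ) :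
    ∃ C : ℝ, ∀ n : ℕ, 1 ≤ n → |cesaro γ n| ≤ C * (n : ℝ) ^ γ := by
  obtain ⟨c, C, hc, hC, h⟩ := exists_omega_bounds hγ
  have hG : 0 < Real.Gamma (γ + 1) := Real.Gamma_pos_of_pos (by linarith)
  refine ⟨Real.Gamma (γ + 1) * C, fun n hn => ?_⟩
  unfold cesaro
  rw [abs_of_pos (mul_pos hG (omega_pos (by linarith) n)), mul_assoc]
  exact mul_le_mul_of_nonneg_left (h n hn).2 hG.le

/-- The defect of `n^γ` begins with `γ(γ+1)/2 n^(γ-1)`. In the recurrence for `γ`, `cesaro (γ-1)`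
has defect exactly `-cesaro (γ-1) n`, so adding it with this coefficient removes the leading term.
-/
lemma exists_expansion_two {γ : ℝ} (hγ : 0 < γ) :
    ∃ C : ℝ, ∀ n : ℕ, 1 ≤ n →
      |(n : ℝ) ^ γ - (cesaro γ n - γ * (γ + 1) / 2 * cesaro (γ - 1) n)|
        ≤ C * ((n : ℝ) ^ γ / (n : ℝ) ^ 2) := by
  obtain ⟨C₁, h₁⟩ := exists_taylor_three (γ + 1)
  obtain ⟨C₂, h₂⟩ := exists_expansion_one (γ := γ - 1) (by linarith)
  obtain ⟨C₃, h₃⟩ := exists_cesaro_le (γ := γ - 1) (by linarith)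
  have hd : 0 < γ * (γ + 1) / 2 := by positivity
  have H := exists_abs_sub_omega_le (γ := γ) (J := 2) (by linarith) (by norm_num)
    (s := fun n => (n : ℝ) ^ γ + γ * (γ + 1) / 2 * cesaro (γ - 1) n)
    (K := C₁ + γ * (γ + 1) / 2 * C₂) (K' := γ * (γ + 1) / 2 * C₃)
  refine Exists.elim (H (fun n hn => ?hs) (fun n hn => ?hl)) fun C hC => ?main
  case main =>
    refine ⟨C, fun n hn => ?_⟩
    have := hC n hn
    unfold cesaro at this ⊢
    convert this using 2
    ring
  case hs =>
    have hn0 : (0 : ℝ) < n := by exact_mod_cast hn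
    have e1 := h₁ (1 / n) (by positivity) (one_div_natCast_le_one hn)
    have e2 := h₂ n hn
    have hrec := rpow_recurrence γ hn
    have hrec' := cesaro_recurrence (γ - 1) n
    rw [Real.rpow_sub_one hn0.ne'] at e2
    have hid : ((n : ℝ) + 1) * ((((n + 1 : ℕ) : ℝ)) ^ γ + γ * (γ + 1) / 2 * cesaro (γ - 1) (n + 1))
        - ((n : ℝ) + 1 + γ) * ((n : ℝ) ^ γ + γ * (γ + 1) / 2 * cesaro (γ - 1) n)
        = (n : ℝ) ^ γ * n * ((1 + 1 / (n : ℝ)) ^ (γ + 1) - 1 - (γ + 1) * (1 / (n : ℝ))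
            - (γ + 1) * (γ + 1 - 1) / 2 * (1 / (n : ℝ)) ^ 2)
          + γ * (γ + 1) / 2 * ((n : ℝ) ^ γ / n - cesaro (γ - 1) n) := by
      have h5 : (n : ℝ) ^ γ * n * ((γ + 1) * (γ + 1 - 1) / 2 * (1 / (n : ℝ)) ^ 2)
          = γ * (γ + 1) / 2 * ((n : ℝ) ^ γ / n) := by field_simp; ring
      linear_combination hrec + γ * (γ + 1) / 2 * hrec' + h5
    rw [hid]
    refine (abs_add_le _ _).trans ?_
    rw [abs_mul, abs_of_nonneg (by positivity), abs_mul, abs_of_pos hd]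
    calc _ ≤ (n : ℝ) ^ γ * n * (C₁ * (1 / n) ^ 3)
          + γ * (γ + 1) / 2 * (C₂ * ((n : ℝ) ^ γ / n / n ^ 1)) := by gcongr
      _ = _ := by field_simp
  case hl =>
    have hn0 : (0 : ℝ) < n := by exact_mod_cast hn
    have e := h₃ n hn
    rw [Real.rpow_sub_one hn0.ne'] at e
    rw [add_sub_cancel_left, abs_mul, abs_of_pos hd, mul_assoc]
    gcongr

lemma exists_expansion_three {γ : ℝ} (hγ : 1 < γ) :
    ∃ c C : ℝ, ∀ n : ℕ, 1 ≤ n →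
      |(n : ℝ) ^ γ - (cesaro γ n - γ * (γ + 1) / 2 * cesaro (γ - 1) n + c * cesaro (γ - 2) n)|
        ≤ C * ((n : ℝ) ^ γ / (n : ℝ) ^ 3) := by
  obtain ⟨C₁, h₁⟩ := exists_taylor_four (γ + 1)
  obtain ⟨C₂, h₂⟩ := exists_expansion_two (γ := γ - 1) (by linarith)
  obtain ⟨C₃, h₃⟩ := exists_expansion_one (γ := γ - 2) (by linarith)
  obtain ⟨C₄, h₄⟩ := exists_cesaro_le (γ := γ - 1) (by linarith)
  obtain ⟨C₅, h₅⟩ := exists_cesaro_le (γ := γ - 2) (by linarith)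
  -- `d` and `e` are the first two coefficients in the defect of `n^γ`. Replacing `cesaro (γ-1)` by
  -- its own expansion changes the second to `e - d γ(γ-1)/2`. It is halved in `c` because `cesaro
  -- (γ-2)` has defect `-2 cesaro (γ-2) n`.
  set d : ℝ := γ * (γ + 1) / 2 with hd'
  set e : ℝ := (γ + 1) * γ * (γ - 1) / 6 with he'
  set c : ℝ := (e - d * ((γ - 1) * (γ - 1 + 1) / 2)) / 2 with hc'
  have hd : 0 < d := by positivity
  have hC₅ : 0 ≤ C₅ := by
    have := (abs_nonneg _).trans (h₅ 1 le_rfl)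
    simpa using this
  have H := exists_abs_sub_omega_le (γ := γ) (J := 3) (by linarith) (by norm_num)
    (s := fun n => (n : ℝ) ^ γ + d * cesaro (γ - 1) n + c * cesaro (γ - 2) n)
    (K := C₁ + d * C₂ + |e| * C₃) (K' := d * C₄ + |c| * C₅)
  refine Exists.elim (H (fun n hn => ?hs) (fun n hn => ?hl)) fun C hC => ?main
  case main =>
    refine ⟨-c, C, fun n hn => ?_⟩
    have := hC n hn
    unfold cesaro at this ⊢
    convert this using 2
    ring
  case hs =>
    have hn0 : (0 : ℝ) < n := by exact_mod_cast hn
    have e1 := h₁ (1 / n) (by positivity) (one_div_natCast_le_one hn)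
    have e2 := h₂ n hn
    have e3 := h₃ n hn
    have hrec := rpow_recurrence γ hn
    have hrec' := cesaro_recurrence (γ - 1) n
    have hrec'' := cesaro_recurrence (γ - 2) n
    have hg2 : (n : ℝ) ^ (γ - 2) = (n : ℝ) ^ γ / n ^ 2 := by
      rw [show (2 : ℝ) = (2 : ℕ) by norm_num, Real.rpow_sub_natCast hn0.ne']
    rw [show γ - 1 - 1 = γ - 2 by ring, Real.rpow_sub_one hn0.ne'] at e2
    rw [hg2] at e3
    have hid : ((n : ℝ) + 1) * ((((n + 1 : ℕ) : ℝ)) ^ γ + d * cesaro (γ - 1) (n + 1)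
          + c * cesaro (γ - 2) (n + 1))
        - ((n : ℝ) + 1 + γ) * ((n : ℝ) ^ γ + d * cesaro (γ - 1) n + c * cesaro (γ - 2) n)
        = (n : ℝ) ^ γ * n * ((1 + 1 / (n : ℝ)) ^ (γ + 1) - 1 - (γ + 1) * (1 / (n : ℝ))
            - (γ + 1) * (γ + 1 - 1) / 2 * (1 / (n : ℝ)) ^ 2
            - (γ + 1) * (γ + 1 - 1) * (γ + 1 - 2) / 6 * (1 / (n : ℝ)) ^ 3)
          + d * ((n : ℝ) ^ γ / n - (cesaro (γ - 1) n
            - (γ - 1) * (γ - 1 + 1) / 2 * cesaro (γ - 2) n))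
          + e * ((n : ℝ) ^ γ / n ^ 2 - cesaro (γ - 2) n) := by
      have h5 : (n : ℝ) ^ γ * n * ((γ + 1) * (γ + 1 - 1) / 2 * (1 / (n : ℝ)) ^ 2)
          = d * ((n : ℝ) ^ γ / n) := by rw [hd']; field_simp; ring
      have h6 : (n : ℝ) ^ γ * n * ((γ + 1) * (γ + 1 - 1) * (γ + 1 - 2) / 6 * (1 / (n : ℝ)) ^ 3)
          = e * ((n : ℝ) ^ γ / n ^ 2) := by rw [he']; field_simp; ring
      linear_combination hrec + d * hrec' + c * hrec'' + h5 + h6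
    rw [hid]
    refine (abs_add_three _ _ _).trans ?_
    rw [abs_mul, abs_of_nonneg (by positivity), abs_mul, abs_of_pos hd, abs_mul e]
    calc _ ≤ (n : ℝ) ^ γ * n * (C₁ * (1 / n) ^ 4) + d * (C₂ * ((n : ℝ) ^ γ / n / n ^ 2))
          + |e| * (C₃ * ((n : ℝ) ^ γ / n ^ 2 / n ^ 1)) := by gcongr
      _ = _ := by field_simp
  case hl =>
    have hn0 : (0 : ℝ) < n := by exact_mod_cast hn
    have hn1 : (1 : ℝ) ≤ n := by exact_mod_cast hn
    have e4 := h₄ n hn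
    have e5 := h₅ n hn
    have hle : (n : ℝ) ^ (γ - 2) ≤ (n : ℝ) ^ γ / n := by
      rw [← Real.rpow_sub_one hn0.ne']
      exact Real.rpow_le_rpow_of_exponent_le hn1 (by linarith)
    rw [Real.rpow_sub_one hn0.ne'] at e4
    rw [add_assoc, add_sub_cancel_left]
    refine (abs_add_le _ _).trans ?_
    rw [abs_mul, abs_of_pos hd, abs_mul]
    calc _ ≤ d * (C₄ * ((n : ℝ) ^ γ / n)) + |c| * (C₅ * ((n : ℝ) ^ γ / n)) := by
          gcongr
          exact e5.trans (by gcongr)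
      _ = _ := by ring

/-! ### Consistency of the WSGL formula on powers -/

open Asymptotics in
lemma isBigO_omega {α δ : ℝ} (hα1 : α ≤ 1) (h1 : δ ≤ 1 - α) (h2 : -2 ≤ δ) :
    (fun n : ℕ => omega (-δ - 1) n) =O[𝓟 (Set.Ici 1)] fun n : ℕ => (n : ℝ) ^ (1 - α) := by
  rw [isBigO_principal]
  rcases le_or_gt δ 0 with h0 | h0
  · refine ⟨1, fun n hn => ?_⟩
    have hn1 : (1 : ℝ) ≤ n := by exact_mod_cast hn
    rw [one_mul, Real.norm_eq_abs, Real.norm_eq_abs]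
    refine (abs_omega_le_one (by linarith) (by linarith) n).trans ?_
    exact (Real.one_le_rpow hn1 (by linarith)).trans (le_abs_self _)
  · obtain ⟨c, C, -, hC, h⟩ := exists_omega_bounds (γ := δ) (by linarith)
    refine ⟨C, fun n hn => ?_⟩
    have hn1 : (1 : ℝ) ≤ n := by exact_mod_cast hn
    rw [Real.norm_eq_abs, Real.norm_eq_abs, abs_of_pos (omega_pos (by linarith) n),
      abs_of_nonneg (by positivity)]
    refine (h n hn).2.trans ?_
    gcongr

open Asymptotics in
lemma isBigO_rpow_natCast {p q : ℝ} (h : p ≤ q) :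
    (fun n : ℕ => (n : ℝ) ^ p) =O[𝓟 (Set.Ici 1)] fun n : ℕ => (n : ℝ) ^ q := by
  rw [isBigO_principal]
  refine ⟨1, fun n hn => ?_⟩
  have hn1 : (1 : ℝ) ≤ n := by exact_mod_cast hn
  rw [one_mul, Real.norm_eq_abs, Real.norm_eq_abs, abs_of_nonneg (by positivity),
    abs_of_nonneg (by positivity)]
  exact Real.rpow_le_rpow_of_exponent_le hn1 h

open Asymptotics in
-- The weights `g` are absolutely summable, so a bounded remainder stays bounded, and `1 ≤ n^(1-α)`.
lemma isBigO_gWeight_conv {α : ℝ} (h0 : 0 < α) (h1 : α ≤ 1) {r : ℕ → ℝ} {C : ℝ}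
    (hr : ∀ n, 1 ≤ n → |r n| ≤ C) :
    (fun n : ℕ => ∑ k ∈ range (n + 1), gWeight α (n - k) * r k) =O[𝓟 (Set.Ici 1)]
      fun n : ℕ => (n : ℝ) ^ (1 - α) := by
  rw [isBigO_principal]
  refine ⟨4 * max C |r 0|, fun n hn => ?_⟩
  have hn1 : (1 : ℝ) ≤ n := by exact_mod_cast hn
  have hr' : ∀ k, |r k| ≤ max C |r 0| := by
    intro k
    rcases Nat.eq_zero_or_pos k with rfl | hk
    · exact le_max_right _ _
    · exact (hr k hk).trans (le_max_left _ _)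
  have hm : 0 ≤ max C |r 0| := (abs_nonneg _).trans (hr' 0)
  rw [Real.norm_eq_abs, Real.norm_eq_abs]
  have hone : 1 ≤ |(n : ℝ) ^ (1 - α)| :=
    (Real.one_le_rpow hn1 (by linarith)).trans (le_abs_self _)
  calc _ ≤ ∑ k ∈ range (n + 1), |gWeight α (n - k) * r k| := Finset.abs_sum_le_sum_abs _ _
    _ ≤ ∑ k ∈ range (n + 1), |gWeight α (n - k)| * max C |r 0| := by
        refine Finset.sum_le_sum fun k _ => ?_
        rw [abs_mul]
        exact mul_le_mul_of_nonneg_left (hr' k) (abs_nonneg _)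
    _ ≤ 4 * max C |r 0| := by
        rw [← Finset.sum_mul]
        exact mul_le_mul_of_nonneg_right (sum_abs_gWeight_le h0.le h1 n) hm
    _ ≤ _ := le_mul_of_one_le_right (by positivity) hone

lemma gWeight_conv_cesaro (α δ : ℝ) (n : ℕ) :
    ∑ k ∈ range (n + 1), gWeight α (n - k) * cesaro δ k
      = Real.Gamma (δ + 1) * (omega (-(δ - α) - 1) n + α / 2 * omega (-(δ - α - 1) - 1) n) := by
  have h := gWeight_conv α (-δ - 1) n
  rw [show -(δ - α) - 1 = α + (-δ - 1) by ring, show -(δ - α - 1) - 1 = α + 1 + (-δ - 1) by ring,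
    ← h, Finset.mul_sum]
  refine Finset.sum_congr rfl fun k _ => ?_
  unfold cesaro
  ring

lemma rpow_div_pow_le_one {p : ℝ} {m n : ℕ} (hp : p ≤ m) (hn : 1 ≤ n) :
    (n : ℝ) ^ p / (n : ℝ) ^ m ≤ 1 := by
  have hn1 : (1 : ℝ) ≤ n := by exact_mod_cast hn
  rw [div_le_one (by positivity), ← Real.rpow_natCast]
  exact Real.rpow_le_rpow_of_exponent_le hn1 hp

lemma le_of_le_mul_rpow_div_pow {f : ℕ → ℝ} {C p : ℝ} {m : ℕ} (hp : p ≤ m)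
    (h : ∀ n : ℕ, 1 ≤ n → |f n| ≤ C * ((n : ℝ) ^ p / (n : ℝ) ^ m)) (n : ℕ) (hn : 1 ≤ n) :
    |f n| ≤ C := by
  have hC : 0 ≤ C := by
    have := (abs_nonneg _).trans (h 1 le_rfl)
    simpa using this
  exact (h n hn).trans (mul_le_of_le_one_right hC (rpow_div_pow_le_one hp hn))

open Asymptotics in
lemma isBigO_of_le_mul_rpow_div_pow {f : ℕ → ℝ} {C p q : ℝ} {m : ℕ} (hp : p - m ≤ q)
    (h : ∀ n : ℕ, 1 ≤ n → |f n| ≤ C * ((n : ℝ) ^ p / (n : ℝ) ^ m)) :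
    f =O[𝓟 (Set.Ici 1)] fun n : ℕ => (n : ℝ) ^ q := by
  refine IsBigO.trans ?_ (isBigO_rpow_natCast hp)
  rw [isBigO_principal]
  refine ⟨C, fun n hn => ?_⟩
  have hn0 : (0 : ℝ) < n := by exact_mod_cast hn
  rw [Real.norm_eq_abs, Real.norm_eq_abs, abs_of_nonneg (a := _ ^ _) (by positivity),
    Real.rpow_sub_natCast hn0.ne']
  exact h n hn

open Asymptotics in
-- Second-order consistency: on `k^β` the formula errs by `O(n^(β-α-2))` plus a bounded part, and `β
-- ≤ 3` makes the former `O(n^(1-α))`. The number of terms that have to cancel grows with `β`, hence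
-- the three ranges.
lemma isBigO_consistency {α β : ℝ} (h0 : 0 < α) (h1 : α ≤ 1) (hβ : 0 < β) (hβ3 : β ≤ 3) :
    (fun n : ℕ => Real.Gamma (β + 1) / Real.Gamma (β - α + 1) * (n : ℝ) ^ (β - α)
        - ∑ k ∈ range (n + 1), gWeight α (n - k) * (k : ℝ) ^ β) =O[𝓟 (Set.Ici 1)]
      fun n : ℕ => (n : ℝ) ^ (1 - α) := by
  have hΓ : Real.Gamma (β - α + 1) ≠ 0 := (Real.Gamma_pos_of_pos (by linarith)).ne'
  set K := Real.Gamma (β + 1) with hK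
  set γ := β - α with hγ
  rcases le_or_gt β 1 with hβ1 | hβ1
  -- For `β ≤ 1` no cancellation is needed: each term separately is `O(n^(1-α))`.
  · obtain ⟨C, hC⟩ := exists_expansion_one (γ := β) (by linarith)
    have hr := isBigO_gWeight_conv h0 h1 (le_of_le_mul_rpow_div_pow (by simpa using hβ1) hC)
    have hp : (fun n : ℕ => (n : ℝ) ^ γ) =O[𝓟 (Set.Ici 1)] fun n : ℕ => (n : ℝ) ^ (1 - α) :=
      isBigO_rpow_natCast (by linarith)
    have ho1 := isBigO_omega (δ := γ) h1 (by linarith) (by linarith)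
    have ho2 := isBigO_omega (δ := γ - 1) h1 (by linarith) (by linarith)
    refine ((((hp.const_mul_left (K / Real.Gamma (γ + 1))).sub
      (ho1.const_mul_left K)).sub (ho2.const_mul_left (K * (α / 2)))).sub hr).congr_left ?_
    intro n
    simp only [mul_sub, Finset.sum_sub_distrib, gWeight_conv_cesaro]
    ring
  have hKβ : K = β * Real.Gamma β := Real.Gamma_add_one hβ.ne'
  rcases le_or_gt β 2 with hβ2 | hβ2
  -- For `1 < β ≤ 2` the leading terms of order `n^(β-α)` must cancel; those of order `n^(β-α-1)`
  -- are admissible.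
  · obtain ⟨C, hC⟩ := exists_expansion_two hβ
    have hr := isBigO_gWeight_conv h0 h1 (le_of_le_mul_rpow_div_pow (by simpa using hβ2) hC)
    obtain ⟨C', hC'⟩ := exists_expansion_one (γ := γ) (by linarith)
    have hp := isBigO_of_le_mul_rpow_div_pow (q := 1 - α) (by push_cast; linarith) hC'
    have ho1 := isBigO_omega (δ := γ - 1) h1 (by linarith) (by linarith)
    have ho2 := isBigO_omega (δ := γ - 1 - 1) h1 (by linarith) (by linarith)
    refine ((((hp.const_mul_left (K / Real.Gamma (γ + 1))).add
      (ho1.const_mul_left (K * ((β + 1) / 2 - α / 2)))).add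
      (ho2.const_mul_left (K * ((β + 1) / 2 * (α / 2))))).sub hr).congr_left ?_
    intro n
    simp only [mul_sub, Finset.sum_sub_distrib, gWeight_conv_cesaro,
      mul_left_comm _ (β * (β + 1) / 2), ← Finset.mul_sum]
    rw [show β - 1 - α = γ - 1 by rw [hγ]; ring, ← hK, ← hγ, sub_add_cancel]
    simp only [cesaro]
    rw [hKβ]
    field_simp
    ring
  -- For `2 < β ≤ 3` the order `n^(β-α-1)` must vanish too. Its coefficient is proportional to
  -- `(β+1)/2 - α/2 - (γ+1)/2`, which is zero as `γ = β - α`. The value of `c` does not matter.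
  · obtain ⟨c, C, hC⟩ := exists_expansion_three (γ := β) (by linarith)
    have hr := isBigO_gWeight_conv h0 h1 (le_of_le_mul_rpow_div_pow (by simpa using hβ3) hC)
    obtain ⟨C', hC'⟩ := exists_expansion_two (γ := γ) (by linarith)
    have hp := isBigO_of_le_mul_rpow_div_pow (q := 1 - α) (by push_cast; linarith) hC'
    have ho2 := isBigO_omega (δ := γ - 1 - 1) h1 (by linarith) (by linarith)
    have ho3 := isBigO_omega (δ := γ - 2 - 1) h1 (by linarith) (by linarith)
    set d := β * (β + 1) / 2 with hd
    have hG2 : Real.Gamma (γ + 1) = γ * Real.Gamma γ := Real.Gamma_add_one (by linarith)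
    refine ((((hp.const_mul_left (K / Real.Gamma (γ + 1))).add
      (ho2.const_mul_left (K * ((β + 1) / 2 * (α / 2)) - c * Real.Gamma (β - 2 + 1)))).sub
      (ho3.const_mul_left (c * Real.Gamma (β - 2 + 1) * (α / 2)))).sub hr).congr_left ?_
    intro n
    simp only [mul_sub, mul_add, Finset.sum_sub_distrib, Finset.sum_add_distrib, mul_left_comm _ c,
      mul_left_comm _ d, ← Finset.mul_sum]
    simp only [gWeight_conv_cesaro]
    rw [show β - 1 - α = γ - 1 by rw [hγ]; ring, show β - 2 - α = γ - 2 by rw [hγ]; ring,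
      ← hK, ← hγ, sub_add_cancel]
    simp only [cesaro]
    rw [sub_add_cancel, show γ - 2 = γ - 1 - 1 by ring, hG2, hKβ, hd]
    have hΓ' : Real.Gamma γ ≠ 0 := (Real.Gamma_pos_of_pos (by linarith)).ne'
    have hγ0 : γ ≠ 0 := by linarith
    have hαβ : α = β - γ := by rw [hγ]; ring
    field_simp
    rw [hαβ]
    ring

/-! ### Generalized Vandermonde systems -/

/-- Descartes' argument: dividing by `x^(p 0)` makes one term constant, and differentiating removes
it. By Rolle the derivative, with `m` terms, vanishes at `m` points interlaced with the given zeros,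
so induction applies. -/
lemma rpow_sum_eq_zero : ∀ (m : ℕ) (p c z : Fin m → ℝ), Function.Injective p → StrictMono z →
    (∀ k, 0 < z k) → (∀ k, ∑ r, c r * z k ^ p r = 0) → c = 0
  | 0, _, c, _, _, _, _, _ => Subsingleton.elim _ _
  | m + 1, p, c, z, hp, hz, hz0, h => by
    have hder : ∀ x : ℝ, 0 < x → HasDerivAt (fun x : ℝ => ∑ r, c r * x ^ (p r - p 0))
        (∑ r, c r * ((p r - p 0) * x ^ (p r - p 0 - 1))) x := fun x hx =>
      HasDerivAt.fun_sum fun r _ => (Real.hasDerivAt_rpow_const (Or.inl hx.ne')).const_mul _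
    have hval : ∀ k, ∑ r, c r * z k ^ (p r - p 0) = 0 := by
      intro k
      have : ∑ r, c r * z k ^ (p r - p 0) = (∑ r, c r * z k ^ p r) / z k ^ p 0 := by
        rw [Finset.sum_div]
        exact Finset.sum_congr rfl fun r _ => by rw [Real.rpow_sub (hz0 k)]; ring
      rw [this, h, zero_div]
    have hroll : ∀ k : Fin m, ∃ ξ ∈ Set.Ioo (z k.castSucc) (z k.succ),
        ∑ r, c r * ((p r - p 0) * ξ ^ (p r - p 0 - 1)) = 0 := by
      intro k
      refine exists_hasDerivAt_eq_zero (hz k.castSucc_lt_succ) ?_ ?_ ?_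
        (f := fun x : ℝ => ∑ r, c r * x ^ (p r - p 0))
      · intro x hx
        exact (hder x ((hz0 _).trans_le hx.1)).continuousAt.continuousWithinAt
      · simp only [hval]
      · exact fun x hx => hder x ((hz0 _).trans hx.1)
    choose ξ hξ hξ0 using hroll
    have ih := rpow_sum_eq_zero m (fun r => p r.succ - p 0 - 1)
      (fun r => c r.succ * (p r.succ - p 0)) ξ ?_ ?_ (fun k => (hz0 _).trans (hξ k).1) ?_
    · have hc : ∀ r : Fin m, c r.succ = 0 := by
        intro r
        have h1 := congrFun ih r
        simp only [Pi.zero_apply, mul_eq_zero, sub_eq_zero] at h1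
        exact h1.resolve_right fun h2 => Fin.succ_ne_zero r (hp h2)
      have h0 := h 0
      rw [Fin.sum_univ_succ] at h0
      simp only [hc, zero_mul, Finset.sum_const_zero, add_zero, mul_eq_zero] at h0
      have hc0 : c 0 = 0 := h0.resolve_right (Real.rpow_pos_of_pos (hz0 0) _).ne'
      funext r
      exact Fin.cases hc0 hc r
    · intro r s hrs
      have : p r.succ = p s.succ := by simpa using hrs
      exact Fin.succ_injective _ (hp this)
    · intro k l hkl
      exact (hξ k).2.trans_le ((hz.monotone (Fin.succ_le_castSucc_iff.2 hkl)).trans (hξ l).1.le)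
    · intro k
      have := hξ0 k
      rw [Fin.sum_univ_succ] at this
      simp only [sub_self, zero_mul, mul_zero, zero_add] at this
      rw [← this]
      exact Finset.sum_congr rfl fun r _ => by ring

/-- Solutions of the generalized Vandermonde systems with nodes `1, ..., m` are bounded by the
data. -/
lemma exists_vandermonde_bound {p : ℕ → ℝ} {m : ℕ} (hp : Set.InjOn p (Set.Icc 1 m)) :
    ∃ B : ℝ, 0 ≤ B ∧ ∀ (x : ℕ → ℝ) (ε : ℝ),
      (∀ r ∈ Icc 1 m, |∑ k ∈ Icc 1 m, x k * (k : ℝ) ^ p r| ≤ ε) →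
      ∀ k ∈ Icc 1 m, |x k| ≤ B * ε := by
  have hsum : ∀ f : ℕ → ℝ, ∑ k ∈ Icc 1 m, f k = ∑ k : Fin m, f (k + 1) := by
    intro f
    rw [← Finset.sum_range (fun k => f (k + 1)), Finset.range_eq_Ico, Finset.sum_Ico_add' f 0 m 1]
    rfl
  let V : Matrix (Fin m) (Fin m) ℝ := fun k r => (((k : ℕ) + 1 : ℕ) : ℝ) ^ p (r + 1)
  -- A kernel vector of `V` would give a sum of `m` real powers vanishing at `1, ..., m`.
  have hV : IsUnit V.det := by
    rw [isUnit_iff_ne_zero]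
    intro h
    obtain ⟨c, hc0, hc⟩ := Matrix.exists_mulVec_eq_zero_iff.2 h
    refine hc0 (rpow_sum_eq_zero m (fun r => p (r + 1)) c (fun k => (((k : ℕ) + 1 : ℕ) : ℝ))
      ?_ ?_ (fun k => by positivity) fun k => ?_)
    · intro r s hrs
      have := hp ⟨by omega, by omega⟩ ⟨by omega, by omega⟩ hrs
      exact Fin.ext (by omega)
    · intro k l hkl
      have : (k : ℕ) < l := hkl
      show (((k : ℕ) + 1 : ℕ) : ℝ) < (((l : ℕ) + 1 : ℕ) : ℝ)
      exact_mod_cast Nat.succ_lt_succ this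
    · have := congrFun hc k
      simp only [Matrix.mulVec, dotProduct, Pi.zero_apply] at this
      rw [← this]
      exact Finset.sum_congr rfl fun r _ => mul_comm _ _
  refine ⟨∑ r : Fin m, ∑ k : Fin m, |V⁻¹ r k|, by positivity, fun x ε hx k hk => ?_⟩
  rw [Finset.mem_Icc] at hk
  obtain ⟨i, rfl⟩ : ∃ i : Fin m, k = i + 1 := ⟨⟨k - 1, by omega⟩, by simp; omega⟩
  set y : Fin m → ℝ := fun k => x (k + 1) with hy
  have hε : ∀ r : Fin m, |(Matrix.vecMul y V) r| ≤ ε := by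
    intro r
    have := hx (r + 1) (Finset.mem_Icc.2 ⟨by omega, by omega⟩)
    rw [hsum] at this
    exact this
  have hε0 : 0 ≤ ε := (abs_nonneg _).trans (hε i)
  have hinv : Matrix.vecMul (Matrix.vecMul y V) V⁻¹ = y := by
    rw [Matrix.vecMul_vecMul, Matrix.mul_nonsing_inv V hV, Matrix.vecMul_one]
  have hi : x (i + 1) = ∑ r, (Matrix.vecMul y V) r * V⁻¹ r i := by
    conv_lhs => rw [show x (i + 1) = y i from rfl, ← hinv]
    rfl
  rw [hi, Finset.sum_mul]
  refine (Finset.abs_sum_le_sum_abs _ _).trans (Finset.sum_le_sum fun r _ => ?_)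
  rw [abs_mul, mul_comm]
  gcongr
  · exact Finset.single_le_sum (f := fun k => |V⁻¹ r k|) (fun _ _ => abs_nonneg _)
      (Finset.mem_univ i)
  · exact hε r

/-! ### Bounds for the starting weights -/

lemma exists_common_bound (m : ℕ) {P : ℕ → ℝ → Prop} (hmono : ∀ r C C', C ≤ C' → P r C → P r C')
    (h : ∀ r ∈ Icc 1 m, ∃ C, P r C) : ∃ C, 0 ≤ C ∧ ∀ r ∈ Icc 1 m, P r C := by
  choose! C hC using h
  refine ⟨∑ r ∈ Icc 1 m, |C r|, by positivity, fun r hr => hmono r (C r) _ ?_ (hC r hr)⟩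
  exact (le_abs_self _).trans
    (Finset.single_le_sum (f := fun r => |C r|) (fun _ _ => abs_nonneg _) hr)

section Weights

variable {σ : ℕ → ℝ} {m : ℕ} {w : ℕ → ℕ → ℝ}

lemma strictMonoOn_exponents (hσ : ∀ r, 1 ≤ r → 1 < σ r ∧ σ r < σ (r + 1)) :
    StrictMonoOn σ (Set.Ici 1) := by
  have : StrictMono fun r => σ (r + 1) :=
    strictMono_nat_of_lt_succ fun r => (hσ (r + 1) (by omega)).2
  intro r hr s hs hrs
  have h := this (a := r - 1) (b := s - 1) (by have : 1 ≤ r := hr; omega)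
  simpa [Nat.sub_add_cancel (show 1 ≤ r from hr), Nat.sub_add_cancel (show 1 ≤ s from hs)] using h

lemma exponents_le (hσ : ∀ r, 1 ≤ r → 1 < σ r ∧ σ r < σ (r + 1)) {B : ℝ}
    (hm : 1 ≤ m → σ m ≤ B) {r : ℕ} (hr : r ∈ Icc 1 m) : σ r ≤ B := by
  rw [Finset.mem_Icc] at hr
  have hm1 : 1 ≤ m := hr.1.trans hr.2
  exact ((strictMonoOn_exponents hσ).monotoneOn hr.1 hm1 hr.2).trans (hm hm1)

/-- Level 0 is kept apart: the weights there may be arbitrary, and `ρ 0` may vanish. -/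
lemma bound_of_eventual_bound {ρ : ℕ → ℝ}
    (h : ∃ C : ℝ, ∀ n : ℕ, 1 ≤ n → ∀ k ∈ Icc 1 m, |w n k| ≤ C * ρ n) (hρ : ∀ n, 1 ≤ n → 0 ≤ ρ n) :
    ∃ C : ℝ, 0 ≤ C ∧ (∀ k ∈ Icc 1 m, |w 0 k| ≤ C) ∧
      ∀ n : ℕ, 1 ≤ n → ∀ k ∈ Icc 1 m, |w n k| ≤ C * ρ n := by
  obtain ⟨C, hC⟩ := h
  have hs : 0 ≤ ∑ k ∈ Icc 1 m, |w 0 k| := by positivity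
  refine ⟨|C| + ∑ k ∈ Icc 1 m, |w 0 k|, by positivity, fun k hk => ?_, fun n hn k hk => ?_⟩
  · have := Finset.single_le_sum (f := fun k => |w 0 k|) (fun _ _ => abs_nonneg _) hk
    have h2 := abs_nonneg C
    linarith
  · refine (hC n hn k hk).trans (mul_le_mul_of_nonneg_right ?_ (hρ n hn))
    have := le_abs_self C
    linarith

lemma IsStartingWeightU.exists_bound (hσ : ∀ r, 1 ≤ r → 1 < σ r ∧ σ r < σ (r + 1))
    (hm : 1 ≤ m → σ m ≤ 3) (hw : IsStartingWeightU σ m w) :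
    ∃ C : ℝ, 0 ≤ C ∧ ∀ n, ∀ k ∈ Icc 1 m, |w n k| ≤ C := by
  obtain ⟨B, hB0, hB⟩ := exists_vandermonde_bound (p := σ) (m := m)
    ((strictMonoOn_exponents hσ).injOn.mono fun r hr => hr.1)
  obtain ⟨C, hC0, hC⟩ := exists_common_bound m (P := fun r C => ∀ n : ℕ, 1 ≤ n →
      |σ r / 2 * (((n : ℝ) + 1) ^ (σ r - 1) + (n : ℝ) ^ (σ r - 1))
        - (((n : ℝ) + 1) ^ σ r - (n : ℝ) ^ σ r)| ≤ C)
    (fun r C C' hCC h n hn => (h n hn).trans hCC)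
    (fun r hr => exists_trapezoid_bound (exponents_le hσ hm hr))
  obtain ⟨D, hD0, hD, hD'⟩ := bound_of_eventual_bound (w := w) (m := m) (ρ := fun _ => 1)
    ⟨B * C, fun n hn k hk => by
      rw [mul_one]
      exact hB (w n) C (fun r hr => by rw [hw n r hr]; exact hC r hr n hn) k hk⟩
    (fun _ _ => zero_le_one)
  refine ⟨D, hD0, fun n k hk => ?_⟩
  rcases Nat.eq_zero_or_pos n with rfl | hn
  · exact hD k hk
  · simpa using hD' n hn k hk

lemma IsStartingWeightV.exists_bound (hσ : ∀ r, 1 ≤ r → 1 < σ r ∧ σ r < σ (r + 1))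
    (hm : 1 ≤ m → σ m ≤ 4) (hw : IsStartingWeightV σ m w) :
    ∃ C : ℝ, 0 ≤ C ∧ ∀ n, ∀ k ∈ Icc 1 m, |w n k| ≤ C := by
  obtain ⟨B, hB0, hB⟩ := exists_vandermonde_bound (p := fun r => σ r - 1) (m := m)
    (fun r hr s hs h => (strictMonoOn_exponents hσ).injOn hr.1 hs.1 (by simpa using h))
  obtain ⟨C, hC0, hC⟩ := exists_common_bound m (P := fun r C => ∀ n : ℕ, 1 ≤ n →
      |(σ r - 1) / 2 * (((n : ℝ) + 1) ^ (σ r - 1 - 1) + (n : ℝ) ^ (σ r - 1 - 1))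
        - (((n : ℝ) + 1) ^ (σ r - 1) - (n : ℝ) ^ (σ r - 1))| ≤ C)
    (fun r C C' hCC h n hn => (h n hn).trans hCC)
    (fun r hr => exists_trapezoid_bound (by linarith [exponents_le hσ hm hr]))
  obtain ⟨D, hD0, hD, hD'⟩ := bound_of_eventual_bound (w := w) (m := m) (ρ := fun _ => 1)
    ⟨B * C, fun n hn k hk => by
      rw [mul_one]
      refine hB (w n) C (fun r hr => ?_) k hk
      have := hC r hr n hn
      rw [hw n hn r hr]
      rwa [show σ r - 1 - 1 = σ r - 2 by ring] at this⟩
    (fun _ _ => zero_le_one)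
  refine ⟨D, hD0, fun n k hk => ?_⟩
  rcases Nat.eq_zero_or_pos n with rfl | hn
  · exact hD k hk
  · simpa using hD' n hn k hk

lemma IsStartingWeightW.exists_bound {α : ℝ} (h0 : 0 < α) (h1 : α ≤ 1)
    (hσ : ∀ r, 1 ≤ r → 1 < σ r ∧ σ r < σ (r + 1))
    (hm : 1 ≤ m → σ m ≤ 4) (hw : IsStartingWeightW α σ m w) :
    ∃ C : ℝ, 0 ≤ C ∧ (∀ k ∈ Icc 1 m, |w 0 k| ≤ C) ∧
      ∀ n : ℕ, 1 ≤ n → ∀ k ∈ Icc 1 m, |w n k| ≤ C * (n : ℝ) ^ (1 - α) := by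
  obtain ⟨B, hB0, hB⟩ := exists_vandermonde_bound (p := fun r => σ r - 1) (m := m)
    (fun r hr s hs h => (strictMonoOn_exponents hσ).injOn hr.1 hs.1 (by simpa using h))
  obtain ⟨C, hC0, hC⟩ := exists_common_bound m (P := fun r C => ∀ n : ℕ, 1 ≤ n →
      |Real.Gamma (σ r) / Real.Gamma (σ r - α) * (n : ℝ) ^ (σ r - 1 - α)
        - ∑ k ∈ Finset.range (n + 1), gWeight α (n - k) * (k : ℝ) ^ (σ r - 1)|
        ≤ C * (n : ℝ) ^ (1 - α))
    (fun r C C' hCC h n hn => (h n hn).trans (by gcongr))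
    (fun r hr => by
      have hr4 := exponents_le hσ hm hr
      have hr1 := (hσ r (Finset.mem_Icc.1 hr).1).1
      have h := isBigO_consistency h0 h1 (β := σ r - 1) (by linarith) (by linarith)
      rw [Asymptotics.isBigO_principal] at h
      obtain ⟨C, hC⟩ := h
      refine ⟨C, fun n hn => ?_⟩
      have := hC n hn
      rwa [Real.norm_eq_abs, Real.norm_eq_abs, abs_of_nonneg (a := _ ^ (1 - α)) (by positivity),
        sub_add_cancel, show σ r - 1 - α + 1 = σ r - α by ring] at this)
  refine bound_of_eventual_bound ⟨B * C, fun n hn k hk => ?_⟩ fun n _ => by positivity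
  rw [mul_assoc]
  exact hB (w n) _ (fun r hr => by rw [hw n hn r hr]; exact hC r hr n hn) k hk

end Weights

/-! ### Positivity of the WSGL quadratic form -/

/-- The discrete convolution of a kernel with a sequence. -/
def conv (K y : ℕ → ℝ) (n : ℕ) : ℝ := ∑ k ∈ range (n + 1), K (n - k) * y k

lemma conv_zero (K y : ℕ → ℝ) : conv K y 0 = K 0 * y 0 := by simp [conv]

lemma conv_succ {K e y : ℕ → ℝ} {p q : ℝ} (h0 : e 0 = p * K 0)
    (hs : ∀ j, e (j + 1) = p * K (j + 1) - q * K j) (n : ℕ) :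
    conv e y (n + 1) = p * conv K y (n + 1) - q * conv K y n := by
  unfold conv
  rw [Finset.sum_range_succ _ (n + 1), Finset.sum_range_succ _ (n + 1)]
  simp only [Nat.sub_self]
  rw [h0, mul_add, Finset.mul_sum, Finset.mul_sum, add_sub_right_comm, ← Finset.sum_sub_distrib]
  congr 1
  · refine Finset.sum_congr rfl fun k hk => ?_
    have hk' : k ≤ n := Nat.lt_succ_iff.1 (Finset.mem_range.1 hk)
    rw [Nat.succ_sub hk', Nat.succ_eq_add_one, hs]
    ring
  · ring

/-- A bound of BDF2 type for `(1 - z) * (1 + α / 2 * (1 - z))`. -/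
lemma sum_two_step_nonneg {α c₁ c₂ : ℝ} (h0 : 0 ≤ α) (h1 : α ≤ 1) (hc₁ : 0 ≤ c₁) (hc₂ : 0 ≤ c₂)
    {X y : ℕ → ℝ} (hX0 : X 0 = 0) (hX1 : X 1 = 0)
    (hy : ∀ n, y n = c₁ * X (n + 2) + c₂ * (X (n + 2) - X (n + 1))) (m : ℕ) :
    0 ≤ ∑ n ∈ range m, ((X (n + 2) - X (n + 1))
      + α / 2 * ((X (n + 2) - X (n + 1)) - (X (n + 1) - X n))) * y n := by
  -- The operator splits as `1-α` times backward Euler plus `α` times BDF2. `Φ` combines their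
  -- energies against `X`, with weight `c₁`, and the energy of the second difference against the
  -- first, with weight `c₂`.
  let Φ : ℕ → ℝ := fun n => c₁ * ((1 - α) * (X (n + 1) ^ 2 / 2)
    + α / 4 * (X (n + 1) ^ 2 + (2 * X (n + 1) - X n) ^ 2)) + c₂ * (α / 4) * (X (n + 1) - X n) ^ 2
  have key : ∀ m, Φ m ≤ ∑ n ∈ range m, ((X (n + 2) - X (n + 1))
      + α / 2 * ((X (n + 2) - X (n + 1)) - (X (n + 1) - X n))) * y n := by
    intro m
    induction m with
    | zero => simp [Φ, hX0, hX1]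
    | succ m ih =>
      rw [Finset.sum_range_succ, hy]
      have e1 : 0 ≤ c₁ * ((1 - α) * (X (m + 2) - X (m + 1)) ^ 2 / 2
          + α / 4 * (X (m + 2) - 2 * X (m + 1) + X m) ^ 2) :=
        mul_nonneg hc₁ (add_nonneg (by have : 0 ≤ 1 - α := by linarith
                                       positivity) (by positivity))
      have e2 : 0 ≤ c₂ * ((X (m + 2) - X (m + 1)) ^ 2
          + α / 4 * ((X (m + 2) - X (m + 1)) - (X (m + 1) - X m)) ^ 2) := by positivity
      simp only [Φ] at ih ⊢
      nlinarith
  refine le_trans ?_ (key m)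
  have : 0 ≤ 1 - α := by linarith
  positivity

/-- The kernel of `(1 + α / 2 * (1 - z)) * e(z)`. -/
def wsglKernel (α : ℝ) (e : ℕ → ℝ) : ℕ → ℝ
  | 0 => (2 + α) / 2 * e 0
  | k + 1 => (2 + α) / 2 * e (k + 1) - α / 2 * e k

lemma gWeight_eq_wsglKernel (α : ℝ) : gWeight α = wsglKernel α (omega α) := by
  funext k
  cases k <;> rfl

/-- With `X = K * y` and `δ = 1 - z`, the kernel acts on `y` as `δX + α/2 δ²X`, while `y` itself is
`c₁ X + c₂ δX`. This is the setting of `sum_two_step_nonneg`. -/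
lemma sum_conv_wsglKernel_nonneg {α c₁ c₂ : ℝ} (h0 : 0 ≤ α) (h1 : α ≤ 1) (hc₁ : 0 ≤ c₁)
    (hc₂ : 0 ≤ c₂) {K e y : ℕ → ℝ} (he0 : e 0 = K 0) (hes : ∀ j, e (j + 1) = K (j + 1) - K j)
    (hy : ∀ n, y n = c₁ * conv K y n + c₂ * conv e y n) (m : ℕ) :
    0 ≤ ∑ n ∈ range m, conv (wsglKernel α e) y n * y n := by
  -- The shift by two zeros makes the two-step formulas valid from `n = 0` on.
  let X : ℕ → ℝ := fun n => match n with
    | 0 => 0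
    | 1 => 0
    | n + 2 => conv K y n
  have hd : ∀ n, conv e y n = X (n + 2) - X (n + 1) := by
    intro n
    cases n with
    | zero => simp [X, conv_zero, he0]
    | succ n =>
      rw [conv_succ (K := K) (p := 1) (q := 1) (by rw [he0, one_mul]) (fun j => by rw [hes]; ring)]
      simp [X]
  have hD : ∀ n, conv (wsglKernel α e) y n = (X (n + 2) - X (n + 1))
      + α / 2 * ((X (n + 2) - X (n + 1)) - (X (n + 1) - X n)) := by
    intro n
    cases n with
    | zero =>
      have := hd 0
      simp only [X, conv_zero] at this ⊢
      simp only [wsglKernel]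
      linear_combination (2 + α) / 2 * this
    | succ n =>
      rw [conv_succ (K := e) (p := (2 + α) / 2) (q := α / 2) rfl (fun j => rfl), hd, hd]
      ring
  simp only [hD]
  exact sum_two_step_nonneg h0 h1 hc₁ hc₂ rfl rfl (fun n => by rw [hy n, hd n]) m

/-- The kernel of `u * (1 - z) / (1 - u * z)`. -/
def resolventKernel (u : ℝ) : ℕ → ℝ
  | 0 => u
  | k + 1 => -(1 - u) * u ^ (k + 1)

/-- Take `K(z) = u/(1-uz)`. Then `1/K = 1/u - z = (1-u)/u + (1-z)`, which is where `c₁ = (1-u)/u`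
and `c₂ = 1` come from; both are nonnegative for `0 < u ≤ 1`. -/
lemma sum_conv_resolventKernel_nonneg {α u : ℝ} (h0 : 0 ≤ α) (h1 : α ≤ 1) (hu0 : 0 < u)
    (hu1 : u ≤ 1) (y : ℕ → ℝ) (m : ℕ) :
    0 ≤ ∑ n ∈ range m, conv (wsglKernel α (resolventKernel u)) y n * y n := by
  have hdelta : ∀ n, conv (fun j => if j = 0 then 1 else 0) y n = y n := by
    intro n
    unfold conv
    rw [Finset.sum_range_succ, Finset.sum_eq_zero]
    · simp
    · intro k hk
      have : n - k ≠ 0 := by have := Finset.mem_range.1 hk; omega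
      simp [this]
  have hes : ∀ j, resolventKernel u (j + 1) = u ^ (j + 1 + 1) - u ^ (j + 1) := fun j => by
    simp only [resolventKernel]; ring
  refine sum_conv_wsglKernel_nonneg h0 h1 (c₁ := (1 - u) / u) (c₂ := 1)
    (div_nonneg (by linarith) hu0.le) zero_le_one (K := fun j => u ^ (j + 1))
    (by simp [resolventKernel]) hes (fun n => ?_) m
  cases n with
  | zero =>
    simp only [conv_zero, resolventKernel]
    field_simp
    ring
  | succ n =>
    rw [conv_succ (K := fun j => u ^ (j + 1)) (e := resolventKernel u) (p := 1) (q := 1)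
      (by simp [resolventKernel]) (fun j => by rw [hes]; ring)]
    have h := conv_succ (K := fun j => u ^ (j + 1)) (y := y) (e := fun j => if j = 0 then 1 else 0)
      (p := 1 / u) (q := 1) (by simp; field_simp) (fun j => by simp; field_simp; ring) n
    rw [hdelta] at h
    rw [h]
    field_simp
    ring

open MeasureTheory in
lemma integrableOn_beta {p q : ℝ} (hp : 0 < p) (hq : 0 < q) :
    IntegrableOn (fun x : ℝ => x ^ (p - 1) * (1 - x) ^ (q - 1)) (Set.Ioc 0 1) ∧
      ∫ x in Set.Ioc (0 : ℝ) 1, x ^ (p - 1) * (1 - x) ^ (q - 1)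
        = Real.Gamma p * Real.Gamma q / Real.Gamma (p + q) := by
  have h := Complex.betaIntegral_convergent (u := p) (v := q) (by simpa) (by simpa)
  rw [intervalIntegrable_iff_integrableOn_Ioc_of_le (by simp)] at h
  have hre : Set.EqOn (fun x : ℝ => RCLike.re
      ((x : ℂ) ^ ((p : ℂ) - 1) * (1 - (x : ℂ)) ^ ((q : ℂ) - 1)))
      (fun x : ℝ => x ^ (p - 1) * (1 - x) ^ (q - 1)) (Set.Ioc 0 1) := by
    intro x ⟨hx1, hx₂⟩
    dsimp only
    norm_cast
    rw [← Complex.ofReal_cpow, ← Complex.ofReal_cpow, RCLike.re_to_complex,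
      Complex.re_mul_ofReal, Complex.ofReal_re]
    all_goals linarith
  refine ⟨IntegrableOn.congr_fun h.re hre measurableSet_Ioc, ?_⟩
  have hb := ProbabilityTheory.beta_eq_betaIntegralReal p q hp hq
  rw [ProbabilityTheory.beta] at hb
  rw [hb, Complex.betaIntegral, intervalIntegral.integral_of_le zero_le_one,
    ← RCLike.re_to_complex, ← integral_re h]
  exact (setIntegral_congr_fun measurableSet_Ioc hre).symm

/-- The density in the representation of `omega α` by resolvent kernels. -/
def resolventDensity (α u : ℝ) : ℝ := u ^ (-α - 1) * (1 - u) ^ (α - 1)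

open MeasureTheory in
-- Coefficientwise form of `Γ(1-α)Γ(α)(1-z)^α = ∫ u(1-z)/(1-uz) u^(-α-1)(1-u)^(α-1) du`. Each
-- coefficient is a Beta integral: the factor `u` tames `u^(-α-1)` at 0.
lemma resolventKernel_integral {α : ℝ} (h0 : 0 < α) (h1 : α < 1) (k : ℕ) :
    IntegrableOn (fun u => resolventKernel u k * resolventDensity α u) (Set.Ioc 0 1) ∧
      ∫ u in Set.Ioc (0 : ℝ) 1, resolventKernel u k * resolventDensity α u
        = Real.Gamma (1 - α) * Real.Gamma α * omega α k := by
  cases k with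
  | zero =>
    obtain ⟨hi, hv⟩ := integrableOn_beta (p := 1 - α) (q := α) (by linarith) h0
    have he : Set.EqOn (fun x : ℝ => x ^ (1 - α - 1) * (1 - x) ^ (α - 1))
        (fun u => resolventKernel u 0 * resolventDensity α u) (Set.Ioc 0 1) := by
      intro x hx
      simp only [resolventKernel, resolventDensity]
      rw [← mul_assoc, show 1 - α - 1 = 1 + (-α - 1) by ring, Real.rpow_add hx.1, Real.rpow_one]
    refine ⟨hi.congr_fun he measurableSet_Ioc, ?_⟩
    rw [← setIntegral_congr_fun measurableSet_Ioc he, hv, omega_zero]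
    simp
  | succ k =>
    have hk : (0 : ℝ) ≤ k := k.cast_nonneg
    obtain ⟨hi, hv⟩ := integrableOn_beta (p := k + 1 - α) (q := α + 1) (by linarith) (by linarith)
    have he : Set.EqOn (fun x : ℝ => -(x ^ ((k : ℝ) + 1 - α - 1) * (1 - x) ^ (α + 1 - 1)))
        (fun u => resolventKernel u (k + 1) * resolventDensity α u) (Set.Ioc 0 1) := by
      intro x hx
      simp only [resolventKernel, resolventDensity]
      have h2 : x ^ ((k : ℝ) + 1 - α - 1) = x ^ (k + 1) * x ^ (-α - 1) := by
        rw [← Real.rpow_natCast, ← Real.rpow_add hx.1]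
        push_cast
        ring_nf
      have h3 : (1 - x) ^ (α + 1 - 1) = (1 - x) * (1 - x) ^ (α - 1) := by
        rw [← Real.rpow_one_add' (by linarith [hx.2]) (by linarith)]
        ring_nf
      rw [h2, h3]
      ring
    refine ⟨IntegrableOn.congr_fun hi.neg he measurableSet_Ioc, ?_⟩
    rw [← setIntegral_congr_fun measurableSet_Ioc he, integral_neg, hv]
    clear hi hv he
    have hGα : Real.Gamma (α + 1) = α * Real.Gamma α := Real.Gamma_add_one h0.ne'
    rw [show (k : ℝ) + 1 - α + (α + 1) = ((k + 1 : ℕ) : ℝ) + 1 by push_cast; ring,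
      Real.Gamma_nat_eq_factorial, hGα]
    induction k with
    | zero =>
      rw [omega_succ_eq, omega_zero]
      simp
      ring
    | succ k ih =>
      have hk : (0 : ℝ) ≤ k := k.cast_nonneg
      rw [omega_succ_eq, mul_left_comm (Real.Gamma (1 - α) * Real.Gamma α), ← ih hk,
        Nat.factorial_succ (k + 1)]
      push_cast
      rw [show (k : ℝ) + 1 + 1 - α = (k + 1 - α) + 1 by ring,
        Real.Gamma_add_one (s := (k : ℝ) + 1 - α) (by linarith)]
      have : ((k + 1).factorial : ℝ) ≠ 0 := by exact_mod_cast (k + 1).factorial_ne_zero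
      have : (k : ℝ) + 1 + 1 ≠ 0 := by positivity
      field_simp

open MeasureTheory in
lemma wsglKernel_integral {α : ℝ} (h0 : 0 < α) (h1 : α < 1) (k : ℕ) :
    IntegrableOn (fun u => wsglKernel α (resolventKernel u) k * resolventDensity α u)
        (Set.Ioc 0 1) ∧
      ∫ u in Set.Ioc (0 : ℝ) 1, wsglKernel α (resolventKernel u) k * resolventDensity α u
        = Real.Gamma (1 - α) * Real.Gamma α * gWeight α k := by
  cases k with
  | zero =>
    obtain ⟨hi, hv⟩ := resolventKernel_integral h0 h1 0
    simp only [wsglKernel, gWeight, mul_assoc]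
    refine ⟨hi.const_mul _, ?_⟩
    rw [integral_const_mul, hv]
    ring
  | succ k =>
    obtain ⟨hi, hv⟩ := resolventKernel_integral h0 h1 k
    obtain ⟨hi', hv'⟩ := resolventKernel_integral h0 h1 (k + 1)
    simp only [wsglKernel, gWeight, mul_assoc, sub_mul]
    refine ⟨(hi'.const_mul _).sub (hi.const_mul _), ?_⟩
    rw [integral_sub (hi'.const_mul _) (hi.const_mul _), integral_const_mul, integral_const_mul,
      hv, hv']
    ring

open MeasureTheory in
theorem sum_conv_gWeight_nonneg {α : ℝ} (h0 : 0 < α) (h1 : α ≤ 1) (y : ℕ → ℝ) (m : ℕ) :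
    0 ≤ ∑ n ∈ range m, conv (gWeight α) y n * y n := by
  rcases h1.eq_or_lt with rfl | h1'
  -- For `α = 1` the Beta integrals degenerate, but `(1-z)^α` is `1-z` itself: `K` is the unit
  -- kernel and `X = y`.
  · have hω : ∀ j, omega 1 (j + 2) = 0 := by
      intro j
      induction j with
      | zero => rw [omega_succ_eq]; simp
      | succ j ih => rw [omega_succ_eq, ih, mul_zero]
    rw [gWeight_eq_wsglKernel]
    refine sum_conv_wsglKernel_nonneg zero_le_one le_rfl (c₁ := 1) (c₂ := 0) zero_le_one le_rfl
      (K := fun j => if j = 0 then 1 else 0) (by simp [omega_zero]) (fun j => ?_) (fun n => ?_) m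
    · cases j with
      | zero => simp [omega_succ_eq, omega_zero]
      | succ j => simp [hω]
    · unfold conv
      rw [Finset.sum_range_succ, Finset.sum_eq_zero]
      · simp
      · intro k hk
        have : n - k ≠ 0 := by have := Finset.mem_range.1 hk; omega
        simp [this]
  · have hG : 0 < Real.Gamma (1 - α) * Real.Gamma α :=
      mul_pos (Real.Gamma_pos_of_pos (by linarith)) (Real.Gamma_pos_of_pos h0)
    have hint : Real.Gamma (1 - α) * Real.Gamma α * ∑ n ∈ range m, conv (gWeight α) y n * y n
        = ∫ u in Set.Ioc (0 : ℝ) 1,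
          (∑ n ∈ range m, conv (wsglKernel α (resolventKernel u)) y n * y n)
            * resolventDensity α u := by
      have hterm : ∀ n k : ℕ, IntegrableOn (fun u => wsglKernel α (resolventKernel u) (n - k)
          * resolventDensity α u * (y k * y n)) (Set.Ioc 0 1) := fun n k =>
        (wsglKernel_integral h0 h1' (n - k)).1.mul_const _
      have hre : ∀ u, (∑ n ∈ range m, conv (wsglKernel α (resolventKernel u)) y n * y n)
            * resolventDensity α u
          = ∑ n ∈ range m, ∑ k ∈ range (n + 1), wsglKernel α (resolventKernel u) (n - k)
            * resolventDensity α u * (y k * y n) := by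
        intro u
        simp only [conv, Finset.sum_mul]
        exact Finset.sum_congr rfl fun n _ => Finset.sum_congr rfl fun k _ => by ring
      simp only [hre]
      rw [integral_finsetSum _ fun n _ => integrable_finsetSum _ fun k _ => hterm n k,
        Finset.mul_sum]
      refine Finset.sum_congr rfl fun n _ => ?_
      rw [integral_finsetSum _ fun k _ => hterm n k, conv, Finset.sum_mul, Finset.mul_sum]
      refine Finset.sum_congr rfl fun k _ => ?_
      rw [integral_mul_const, (wsglKernel_integral h0 h1' (n - k)).2]
      ring
    refine nonneg_of_mul_nonneg_right ?_ hG
    rw [hint]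
    refine setIntegral_nonneg measurableSet_Ioc fun u hu => mul_nonneg
      (sum_conv_resolventKernel_nonneg h0.le h1 hu.1 hu.2 y m) ?_
    exact mul_nonneg (Real.rpow_nonneg hu.1.le _) (Real.rpow_nonneg (by linarith [hu.2]) _)

/-! ### The energy estimate in an inner product space -/

section Energy

variable {E : Type*} [NormedAddCommGroup E] [InnerProductSpace ℝ E]

/-- Only finitely many vectors occur; in an orthonormal basis of their span the form is a sum of
scalar ones. -/
lemma sum_inner_gWeight_nonneg {α : ℝ} (h0 : 0 < α) (h1 : α ≤ 1) (y : ℕ → E) (m : ℕ) :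
    0 ≤ ∑ n ∈ range m, inner ℝ (∑ k ∈ range (n + 1), gWeight α (n - k) • y k) (y n) := by
  let S : Submodule ℝ E := Submodule.span ℝ (y '' (range m : Set ℕ))
  have : FiniteDimensional ℝ S :=
    FiniteDimensional.span_of_finite ℝ ((range m).finite_toSet.image y)
  have hmem : ∀ n ∈ range m, y n ∈ S := fun n hn => Submodule.subset_span ⟨n, hn, rfl⟩
  let B := stdOrthonormalBasis ℝ S
  have hin : ∀ k ∈ range m, ∀ n ∈ range m,
      inner ℝ (y k) (y n) = ∑ i, inner ℝ (y k) (B i : E) * inner ℝ (y n) (B i : E) := by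
    intro k hk n hn
    have h := B.sum_inner_mul_inner ⟨y k, hmem k hk⟩ ⟨y n, hmem n hn⟩
    simp only [Submodule.coe_inner] at h
    rw [← h]
    exact Finset.sum_congr rfl fun i _ => by rw [real_inner_comm (y n)]
  have hsum : ∑ n ∈ range m, inner ℝ (∑ k ∈ range (n + 1), gWeight α (n - k) • y k) (y n)
      = ∑ i, ∑ n ∈ range m, conv (gWeight α) (fun k => inner ℝ (y k) (B i : E)) n
        * inner ℝ (y n) (B i : E) := by
    rw [Finset.sum_comm]
    refine Finset.sum_congr rfl fun n hn => ?_
    simp only [sum_inner, real_inner_smul_left, conv, Finset.sum_mul]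
    rw [Finset.sum_comm]
    refine Finset.sum_congr rfl fun k hk => ?_
    rw [hin k (Finset.mem_range.2 (by
      have := Finset.mem_range.1 hn; have := Finset.mem_range.1 hk; omega)) n hn, Finset.mul_sum]
    exact Finset.sum_congr rfl fun i _ => by ring
  rw [hsum]
  exact Finset.sum_nonneg fun i _ => sum_conv_gWeight_nonneg h0 h1 _ m

lemma norm_sub_zero_le_sum {τ : ℝ} (hτ : 0 < τ) (V : ℕ → E) (r : ℕ) :
    ‖V r - V 0‖ ≤ τ * ∑ j ∈ Icc 1 r, ‖τ⁻¹ • (V j - V (j - 1))‖ := by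
  induction r with
  | zero => simp
  | succ r ih =>
    rw [Finset.sum_Icc_succ_top (by omega), mul_add]
    have h : τ * ‖τ⁻¹ • (V (r + 1) - V (r + 1 - 1))‖ = ‖V (r + 1) - V r‖ := by
      rw [norm_smul, norm_inv, Real.norm_of_nonneg hτ.le, Nat.add_sub_cancel]
      field_simp
    rw [h]
    have := norm_sub_le_norm_sub_add_norm_sub (V (r + 1)) (V r) (V 0)
    linarith

lemma norm_sub_zero_le_of_le {τ : ℝ} (hτ : 0 < τ) (V : ℕ → E) {r m : ℕ} (hr : r ≤ m) :
    ‖V r - V 0‖ ≤ τ * ∑ j ∈ Icc 1 m, ‖τ⁻¹ • (V j - V (j - 1))‖ := by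
  refine (norm_sub_zero_le_sum hτ V r).trans (mul_le_mul_of_nonneg_left ?_ hτ.le)
  exact Finset.sum_le_sum_of_subset_of_nonneg (Finset.Icc_subset_Icc le_rfl hr)
    fun _ _ _ => norm_nonneg _

lemma sq_sum_Icc_le (f : ℕ → ℝ) (m : ℕ) :
    (∑ j ∈ Icc 1 m, f j) ^ 2 ≤ m * ∑ j ∈ Icc 1 m, f j ^ 2 := by
  simpa using sq_sum_le_card_mul_sum_sq (s := Icc 1 m) (f := f)

/-- The two equations of the scheme, tested with the averages of the solution. The sequences `V`,
`U`, `W` stand for `v`, `∂ₓ u`, `∂ₓ v`. -/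
structure TestedScheme (α ν μ τ : ℝ) (nT m₁ m₂ m₃ : ℕ) (uw vw ww : ℕ → ℕ → ℝ)
    (V U W F : ℕ → E) : Prop where
  eq_v : ∀ n < nT,
    inner ℝ (τ⁻¹ • (V (n + 1) - V n)) ((2⁻¹ : ℝ) • (V (n + 1) + V n) - V 0)
      + τ⁻¹ * ∑ r ∈ Icc 1 m₂, vw n r * inner ℝ (V r - V 0) ((2⁻¹ : ℝ) • (V (n + 1) + V n) - V 0)
      + ν / 2 * (inner ℝ ((τ ^ α)⁻¹ • (∑ k ∈ range (n + 1 + 1), gWeight α (n + 1 - k) • (V k - V 0)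
            + ∑ k ∈ Icc 1 m₃, ww (n + 1) k • (V k - V 0))) ((2⁻¹ : ℝ) • (V (n + 1) + V n) - V 0)
          + inner ℝ ((τ ^ α)⁻¹ • (∑ k ∈ range (n + 1), gWeight α (n - k) • (V k - V 0)
            + ∑ k ∈ Icc 1 m₃, ww n k • (V k - V 0))) ((2⁻¹ : ℝ) • (V (n + 1) + V n) - V 0))
      + μ * inner ℝ ((2⁻¹ : ℝ) • (U (n + 1) + U n)) ((2⁻¹ : ℝ) • (W (n + 1) + W n) - W 0)
    = inner ℝ ((2⁻¹ : ℝ) • (F (n + 1) + F n)) ((2⁻¹ : ℝ) • (V (n + 1) + V n) - V 0)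
  eq_u : ∀ n < nT,
    inner ℝ (τ⁻¹ • (U (n + 1) - U n)) ((2⁻¹ : ℝ) • (U (n + 1) + U n))
      + τ⁻¹ * ∑ r ∈ Icc 1 m₁,
          uw n r * inner ℝ (U r - U 0 - ((r : ℝ) * τ) • W 0) ((2⁻¹ : ℝ) • (U (n + 1) + U n))
    = inner ℝ ((2⁻¹ : ℝ) • (W (n + 1) + W n)) ((2⁻¹ : ℝ) • (U (n + 1) + U n))

variable {α ν μ τ T : ℝ} {nT m₁ m₂ m₃ : ℕ} {uw vw ww : ℕ → ℕ → ℝ} {V U W F : ℕ → E}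

/-- The energy identity of the scheme. -/
lemma TestedScheme.energy_identity (h : TestedScheme α ν μ τ nT m₁ m₂ m₃ uw vw ww V U W F)
    {n : ℕ} (hn : n < nT) {y : ℕ → E}
    (hy : ∀ k, y k = (2⁻¹ : ℝ) • (V (k + 1) + V k) - V 0) :
    τ⁻¹ / 2 * ((‖V (n + 1) - V 0‖ ^ 2 + μ * ‖U (n + 1)‖ ^ 2) - (‖V n - V 0‖ ^ 2 + μ * ‖U n‖ ^ 2))
      + ν * (τ ^ α)⁻¹ * inner ℝ (∑ k ∈ range (n + 1), gWeight α (n - k) • y k) (y n)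
    = inner ℝ ((2⁻¹ : ℝ) • (F (n + 1) + F n)) (y n)
      - τ⁻¹ * ∑ r ∈ Icc 1 m₂, vw n r * inner ℝ (V r - V 0) (y n)
      - ν / 2 * (τ ^ α)⁻¹ * ∑ k ∈ Icc 1 m₃, (ww (n + 1) k + ww n k) * inner ℝ (V k - V 0) (y n)
      + μ * inner ℝ (W 0) ((2⁻¹ : ℝ) • (U (n + 1) + U n))
      - μ * τ⁻¹ * ∑ r ∈ Icc 1 m₁,
          uw n r * inner ℝ (U r - U 0 - ((r : ℝ) * τ) • W 0) ((2⁻¹ : ℝ) • (U (n + 1) + U n)) := by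
  have hv := h.eq_v n hn
  have hu := h.eq_u n hn
  simp only [← hy] at hv
  have h1 : inner ℝ (τ⁻¹ • (V (n + 1) - V n)) (y n)
      = τ⁻¹ / 2 * (‖V (n + 1) - V 0‖ ^ 2 - ‖V n - V 0‖ ^ 2) := by
    have e : y n = (2⁻¹ : ℝ) • ((V (n + 1) - V 0) + (V n - V 0)) := by rw [hy]; module
    have e' : V (n + 1) - V n = (V (n + 1) - V 0) - (V n - V 0) := by abel
    rw [e, e', real_inner_smul_left, real_inner_smul_right, inner_sub_left, inner_add_right,
      inner_add_right, real_inner_self_eq_norm_sq, real_inner_self_eq_norm_sq,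
      real_inner_comm (V n - V 0)]
    ring
  have h2 : inner ℝ (τ⁻¹ • (U (n + 1) - U n)) ((2⁻¹ : ℝ) • (U (n + 1) + U n))
      = τ⁻¹ / 2 * (‖U (n + 1)‖ ^ 2 - ‖U n‖ ^ 2) := by
    rw [real_inner_smul_left, real_inner_smul_right, inner_sub_left, inner_add_right,
      inner_add_right, real_inner_self_eq_norm_sq, real_inner_self_eq_norm_sq,
      real_inner_comm (U n)]
    ring
  -- After reindexing level `n+1` by one, the term left over contains `V 0 - V 0 = 0`, so both sums
  -- pair into midpoints.
  have h3 : ∑ k ∈ range (n + 1 + 1), gWeight α (n + 1 - k) • (V k - V 0)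
      + ∑ k ∈ range (n + 1), gWeight α (n - k) • (V k - V 0)
      = (2 : ℝ) • ∑ k ∈ range (n + 1), gWeight α (n - k) • y k := by
    rw [Finset.sum_range_succ']
    simp only [sub_self, smul_zero, add_zero, Nat.add_sub_add_right]
    rw [← Finset.sum_add_distrib, Finset.smul_sum]
    refine Finset.sum_congr rfl fun k _ => ?_
    rw [hy]
    module
  have h4 : inner ℝ ((τ ^ α)⁻¹ • (∑ k ∈ range (n + 1 + 1), gWeight α (n + 1 - k) • (V k - V 0)
            + ∑ k ∈ Icc 1 m₃, ww (n + 1) k • (V k - V 0))) (y n)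
          + inner ℝ ((τ ^ α)⁻¹ • (∑ k ∈ range (n + 1), gWeight α (n - k) • (V k - V 0)
            + ∑ k ∈ Icc 1 m₃, ww n k • (V k - V 0))) (y n)
      = (τ ^ α)⁻¹ * (2 * inner ℝ (∑ k ∈ range (n + 1), gWeight α (n - k) • y k) (y n)
        + ∑ k ∈ Icc 1 m₃, (ww (n + 1) k + ww n k) * inner ℝ (V k - V 0) (y n)) := by
    rw [← inner_add_left, ← smul_add, real_inner_smul_left, add_add_add_comm, h3, inner_add_left,
      real_inner_smul_left, ← Finset.sum_add_distrib]
    simp only [← add_smul, sum_inner, real_inner_smul_left]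
  rw [h4, h1] at hv
  rw [h2] at hu
  rw [inner_sub_right] at hv
  -- The products of the midpoints of `U` and `W` cancel; only the one with `W 0` survives.
  linear_combination hv + μ * hu
    + μ * real_inner_comm ((2⁻¹ : ℝ) • (U (n + 1) + U n)) ((2⁻¹ : ℝ) • (W (n + 1) + W n))
    - μ * real_inner_comm ((2⁻¹ : ℝ) • (U (n + 1) + U n)) (W 0)

/-- A bound for the data terms of the energy identity that do not involve the source. -/
def dataBound (T α ν μ Cu Cv Cw : ℝ) (m₁ m₂ m₃ : ℕ) : ℝ :=
  Cv * m₂ + ν * Cw * T ^ (1 - α) * m₃ + √μ * (1 + Cu * m₁ ^ 2 + Cu * m₁)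

lemma dataBound_combine {Cu Cv Cw w G₁ G₂ G₃ : ℝ} (hT : 0 ≤ T) (hν : 0 ≤ ν)
    (hCu : 0 ≤ Cu) (hCv : 0 ≤ Cv) (hCw : 0 ≤ Cw) (hw : 0 ≤ w) (h₁ : 0 ≤ G₁) (h₂ : 0 ≤ G₂)
    (h₃ : 0 ≤ G₃) :
    Cv * m₂ * G₂ + ν * Cw * T ^ (1 - α) * m₃ * G₃ + √μ * w + Cu * m₁ * (G₁ + m₁ * w) * √μ
      ≤ dataBound T α ν μ Cu Cv Cw m₁ m₂ m₃ * (w + G₁ + G₂ + G₃) := by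
  unfold dataBound
  have hT' : 0 ≤ T ^ (1 - α) := by positivity
  generalize T ^ (1 - α) = θ at *
  have hμ := Real.sqrt_nonneg μ
  generalize √μ = η at *
  have p1 : 0 ≤ Cv * m₂ * (w + G₁ + G₃) := by positivity
  have p2 : 0 ≤ ν * Cw * θ * m₃ * (w + G₁ + G₂) := by positivity
  have p3 : 0 ≤ η * (1 + Cu * m₁) * (G₂ + G₃) + η * G₁ + η * Cu * m₁ * w := by positivity
  have p4 : 0 ≤ η * (Cu * m₁ ^ 2) * (G₁ + G₂ + G₃) := by positivity
  linarith

/-- The extra `τ` is supplied by `V k - V 0`. For `n ≥ 1` the growth of the weights is absorbed by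
`(nτ)^(1-α) ≤ T^(1-α)`; for `n = 0`, `τ ≤ T` suffices. -/
lemma rpow_mul_weight_le {Cw : ℝ} (hα1 : α ≤ 1) (hτ : 0 < τ) (hCw : 0 ≤ Cw)
    (hw0 : ∀ k ∈ Icc 1 m₃, |ww 0 k| ≤ Cw)
    (hw : ∀ n : ℕ, 1 ≤ n → ∀ k ∈ Icc 1 m₃, |ww n k| ≤ Cw * (n : ℝ) ^ (1 - α))
    (hτT : τ ≤ T) {n : ℕ} (hn : n * τ ≤ T) {k : ℕ} (hk : k ∈ Icc 1 m₃) :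
    (τ ^ α)⁻¹ * |ww n k| * τ ≤ Cw * T ^ (1 - α) := by
  have e : (τ ^ α)⁻¹ * τ = τ ^ (1 - α) := by
    rw [Real.rpow_sub hτ, Real.rpow_one, div_eq_mul_inv, mul_comm]
  have e2 : (τ ^ α)⁻¹ * |ww n k| * τ = |ww n k| * τ ^ (1 - α) := by rw [← e]; ring
  rw [e2]
  rcases Nat.eq_zero_or_pos n with rfl | hn1
  · exact mul_le_mul (hw0 k hk) (Real.rpow_le_rpow hτ.le hτT (by linarith)) (by positivity) hCw
  · calc _ ≤ Cw * (n : ℝ) ^ (1 - α) * τ ^ (1 - α) := by gcongr; exact hw n hn1 k hk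
      _ = Cw * (n * τ) ^ (1 - α) := by rw [Real.mul_rpow (by positivity) hτ.le]; ring
      _ ≤ _ := by gcongr

/-- Every term on the right of the energy identity is linear in a midpoint, so by Cauchy–Schwarz
each is `s` times data. Keeping `s` to the first power is what later allows a quadratic inequality
in place of Gronwall. In the corrections of the time differences, `τ⁻¹` is cancelled by the `τ` of
`norm_sub_zero_le_of_le`. -/
lemma TestedScheme.energy_step (h : TestedScheme α ν μ τ nT m₁ m₂ m₃ uw vw ww V U W F)
    {Cu Cv Cw s : ℝ} (hα1 : α ≤ 1) (hν : 0 ≤ ν) (hμ : 0 < μ)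
    (hτ : 0 < τ) (hτT : nT * τ = T) (hCu : 0 ≤ Cu) (hCv : 0 ≤ Cv) (hCw : 0 ≤ Cw)
    (hu : ∀ n, ∀ k ∈ Icc 1 m₁, |uw n k| ≤ Cu) (hv : ∀ n, ∀ k ∈ Icc 1 m₂, |vw n k| ≤ Cv)
    (hw0 : ∀ k ∈ Icc 1 m₃, |ww 0 k| ≤ Cw)
    (hw : ∀ n : ℕ, 1 ≤ n → ∀ k ∈ Icc 1 m₃, |ww n k| ≤ Cw * (n : ℝ) ^ (1 - α))
    {n : ℕ} (hn : n < nT) (hs : 0 ≤ s)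
    (hVs : ∀ k ∈ Icc n (n + 1), ‖V k - V 0‖ ≤ s) (hUs : ∀ k ∈ Icc n (n + 1), √μ * ‖U k‖ ≤ s)
    {y : ℕ → E} (hy : ∀ k, y k = (2⁻¹ : ℝ) • (V (k + 1) + V k) - V 0) :
    (‖V (n + 1) - V 0‖ ^ 2 + μ * ‖U (n + 1)‖ ^ 2) - (‖V n - V 0‖ ^ 2 + μ * ‖U n‖ ^ 2)
      + 2 * τ * ν * (τ ^ α)⁻¹ * inner ℝ (∑ k ∈ range (n + 1), gWeight α (n - k) • y k) (y n)
    ≤ 2 * τ * s * ((‖F (n + 1)‖ + ‖F n‖) / 2 + dataBound T α ν μ Cu Cv Cw m₁ m₂ m₃ *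
        (‖W 0‖ + ∑ r ∈ Icc 1 m₁, ‖τ⁻¹ • (U r - U (r - 1))‖
          + ∑ r ∈ Icc 1 m₂, ‖τ⁻¹ • (V r - V (r - 1))‖
          + ∑ r ∈ Icc 1 m₃, ‖τ⁻¹ • (V r - V (r - 1))‖)) := by
  have hid := h.energy_identity hn hy
  set G₁ := ∑ r ∈ Icc 1 m₁, ‖τ⁻¹ • (U r - U (r - 1))‖ with hG₁
  set G₂ := ∑ r ∈ Icc 1 m₂, ‖τ⁻¹ • (V r - V (r - 1))‖ with hG₂
  set G₃ := ∑ r ∈ Icc 1 m₃, ‖τ⁻¹ • (V r - V (r - 1))‖ with hG₃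
  have hG₁0 : 0 ≤ G₁ := by positivity
  have hG₂0 : 0 ≤ G₂ := by positivity
  have hG₃0 : 0 ≤ G₃ := by positivity
  have hnT : (n : ℝ) + 1 ≤ nT := by exact_mod_cast hn
  have hT1 : τ ≤ T := by
    rw [← hτT]
    have := n.cast_nonneg (α := ℝ)
    nlinarith
  have hT0 : 0 < T := hτ.trans_le hT1
  have hyn : ‖y n‖ ≤ s := by
    have e : y n = (2⁻¹ : ℝ) • ((V (n + 1) - V 0) + (V n - V 0)) := by rw [hy]; module
    rw [e, norm_smul]
    have h1 := hVs n (by simp)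
    have h2 := hVs (n + 1) (by simp)
    have h3 := norm_add_le (V (n + 1) - V 0) (V n - V 0)
    norm_num
    linarith
  set z := (2⁻¹ : ℝ) • (U (n + 1) + U n) with hz
  have hsμ : 0 < √μ := Real.sqrt_pos.2 hμ
  have hzn : μ * ‖z‖ ≤ √μ * s := by
    have h1 := hUs n (by simp)
    have h2 := hUs (n + 1) (by simp)
    have h3 := norm_add_le (U (n + 1)) (U n)
    have h4 : √μ * ‖z‖ ≤ s := by
      rw [hz, norm_smul]
      norm_num
      nlinarith
    calc μ * ‖z‖ = √μ * (√μ * ‖z‖) := by rw [← mul_assoc, Real.mul_self_sqrt hμ.le]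
      _ ≤ _ := by gcongr
  have hin : ∀ x : E, |inner ℝ x (y n)| ≤ ‖x‖ * s := fun x =>
    (abs_real_inner_le_norm x (y n)).trans (by gcongr)
  have hinz : ∀ x : E, μ * |inner ℝ x z| ≤ ‖x‖ * (√μ * s) := fun x => by
    have := abs_real_inner_le_norm x z
    calc μ * |inner ℝ x z| ≤ μ * (‖x‖ * ‖z‖) := by gcongr
      _ = ‖x‖ * (μ * ‖z‖) := by ring
      _ ≤ _ := by gcongr
  -- the source
  have t1 : inner ℝ ((2⁻¹ : ℝ) • (F (n + 1) + F n)) (y n) ≤ (‖F (n + 1)‖ + ‖F n‖) / 2 * s := by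
    refine (le_abs_self _).trans ((hin _).trans ?_)
    gcongr
    rw [norm_smul]
    have := norm_add_le (F (n + 1)) (F n)
    norm_num
    linarith
  -- the correction of the time difference of `v`
  have t2 : -(τ⁻¹ * ∑ r ∈ Icc 1 m₂, vw n r * inner ℝ (V r - V 0) (y n)) ≤ Cv * m₂ * G₂ * s := by
    refine (neg_le_abs _).trans ?_
    rw [Finset.mul_sum]
    refine (Finset.abs_sum_le_sum_abs _ _).trans ?_
    have : ∀ r ∈ Icc 1 m₂, |τ⁻¹ * (vw n r * inner ℝ (V r - V 0) (y n))| ≤ Cv * G₂ * s := by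
      intro r hr
      rw [abs_mul, abs_mul, abs_of_pos (inv_pos.2 hτ)]
      calc _ ≤ τ⁻¹ * (Cv * (τ * G₂ * s)) := by
            gcongr
            · exact hv n r hr
            · refine (hin _).trans ?_
              gcongr
              exact norm_sub_zero_le_of_le hτ V (Finset.mem_Icc.1 hr).2
        _ = _ := by field_simp
    refine (Finset.sum_le_card_nsmul _ _ _ this).trans (le_of_eq ?_)
    simp
    ring
  -- the correction of the WSGL formula
  have t3 : -(ν / 2 * (τ ^ α)⁻¹ * ∑ k ∈ Icc 1 m₃,
        (ww (n + 1) k + ww n k) * inner ℝ (V k - V 0) (y n))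
      ≤ ν * Cw * T ^ (1 - α) * m₃ * G₃ * s := by
    refine (neg_le_abs _).trans ?_
    rw [Finset.mul_sum]
    refine (Finset.abs_sum_le_sum_abs _ _).trans ?_
    have : ∀ k ∈ Icc 1 m₃, |ν / 2 * (τ ^ α)⁻¹ *
        ((ww (n + 1) k + ww n k) * inner ℝ (V k - V 0) (y n))|
        ≤ ν * (Cw * T ^ (1 - α)) * G₃ * s := by
      intro k hk
      have w1 := rpow_mul_weight_le hα1 hτ hCw hw0 hw hT1 (n := n)
        (by rw [← hτT]; gcongr) hk
      have w2 := rpow_mul_weight_le hα1 hτ hCw hw0 hw hT1 (n := n + 1)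
        (by rw [← hτT]; push_cast; gcongr) hk
      have e1 : |inner ℝ (V k - V 0) (y n)| ≤ τ * G₃ * s := by
        refine (hin _).trans ?_
        gcongr
        exact norm_sub_zero_le_of_le hτ V (Finset.mem_Icc.1 hk).2
      rw [abs_mul, abs_mul, abs_mul, abs_of_nonneg (by positivity : 0 ≤ ν / 2),
        abs_of_nonneg (by positivity : 0 ≤ (τ ^ α)⁻¹)]
      calc _ ≤ ν / 2 * (τ ^ α)⁻¹ * ((|ww (n + 1) k| + |ww n k|) * (τ * G₃ * s)) := by
            gcongr
            exact abs_add_le _ _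
        _ = ν / 2 * ((τ ^ α)⁻¹ * |ww (n + 1) k| * τ + (τ ^ α)⁻¹ * |ww n k| * τ) * G₃ * s := by ring
        _ ≤ ν / 2 * (Cw * T ^ (1 - α) + Cw * T ^ (1 - α)) * G₃ * s := by gcongr
        _ = _ := by ring
    refine (Finset.sum_le_card_nsmul _ _ _ this).trans (le_of_eq ?_)
    simp
    ring
  have t4 : μ * inner ℝ (W 0) z ≤ √μ * ‖W 0‖ * s := by
    have h1 := hinz (W 0)
    have h2 := le_abs_self (inner ℝ (W 0) z)
    nlinarith
  -- the correction of the time difference of `u`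
  have t5 : -(μ * τ⁻¹ * ∑ r ∈ Icc 1 m₁, uw n r * inner ℝ (U r - U 0 - ((r : ℝ) * τ) • W 0) z)
      ≤ Cu * m₁ * (G₁ + m₁ * ‖W 0‖) * (√μ * s) := by
    refine (neg_le_abs _).trans ?_
    rw [Finset.mul_sum]
    refine (Finset.abs_sum_le_sum_abs _ _).trans ?_
    have : ∀ r ∈ Icc 1 m₁, |μ * τ⁻¹ * (uw n r * inner ℝ (U r - U 0 - ((r : ℝ) * τ) • W 0) z)|
        ≤ Cu * (G₁ + m₁ * ‖W 0‖) * (√μ * s) := by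
      intro r hr
      have hr' : (r : ℝ) ≤ m₁ := by exact_mod_cast (Finset.mem_Icc.1 hr).2
      have e1 : ‖U r - U 0 - ((r : ℝ) * τ) • W 0‖ ≤ τ * (G₁ + m₁ * ‖W 0‖) := by
        refine (norm_sub_le _ _).trans ?_
        rw [norm_smul, Real.norm_of_nonneg (by positivity)]
        have e2 := norm_sub_zero_le_of_le hτ U (Finset.mem_Icc.1 hr).2
        have e3 : (r : ℝ) * τ * ‖W 0‖ ≤ m₁ * τ * ‖W 0‖ := by gcongr
        linarith
      rw [abs_mul, abs_mul, abs_mul, abs_of_pos hμ, abs_of_pos (inv_pos.2 hτ)]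
      calc _ = τ⁻¹ * |uw n r| * (μ * |inner ℝ (U r - U 0 - ((r : ℝ) * τ) • W 0) z|) := by ring
        _ ≤ τ⁻¹ * Cu * (τ * (G₁ + m₁ * ‖W 0‖) * (√μ * s)) :=
            mul_le_mul (mul_le_mul_of_nonneg_left (hu n r hr) (by positivity))
              ((hinz _).trans (mul_le_mul_of_nonneg_right e1 (by positivity)))
              (by positivity) (by positivity)
        _ = _ := by field_simp
    refine (Finset.sum_le_card_nsmul _ _ _ this).trans (le_of_eq ?_)
    simp
    ring
  have hcomb := dataBound_combine (α := α) (m₁ := m₁) (m₂ := m₂) (m₃ := m₃) hT0.le hν hCu hCv hCw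
    (norm_nonneg (W 0)) hG₁0 hG₂0 hG₃0 (μ := μ)
  have hR : τ⁻¹ / 2 * ((‖V (n + 1) - V 0‖ ^ 2 + μ * ‖U (n + 1)‖ ^ 2)
        - (‖V n - V 0‖ ^ 2 + μ * ‖U n‖ ^ 2))
      + ν * (τ ^ α)⁻¹ * inner ℝ (∑ k ∈ range (n + 1), gWeight α (n - k) • y k) (y n)
      ≤ s * ((‖F (n + 1)‖ + ‖F n‖) / 2
        + dataBound T α ν μ Cu Cv Cw m₁ m₂ m₃ * (‖W 0‖ + G₁ + G₂ + G₃)) := by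
    have := mul_le_mul_of_nonneg_left hcomb hs
    linarith
  have hfin := mul_le_mul_of_nonneg_left hR (by positivity : 0 ≤ 2 * τ)
  have e6 : 2 * τ * (τ⁻¹ / 2) = 1 := by field_simp
  calc _ = 2 * τ * (τ⁻¹ / 2 * ((‖V (n + 1) - V 0‖ ^ 2 + μ * ‖U (n + 1)‖ ^ 2)
        - (‖V n - V 0‖ ^ 2 + μ * ‖U n‖ ^ 2))
      + ν * (τ ^ α)⁻¹ * inner ℝ (∑ k ∈ range (n + 1), gWeight α (n - k) • y k) (y n)) := by
        linear_combination (-((‖V (n + 1) - V 0‖ ^ 2 + μ * ‖U (n + 1)‖ ^ 2)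
        - (‖V n - V 0‖ ^ 2 + μ * ‖U n‖ ^ 2))) * e6
    _ ≤ _ := hfin
    _ = _ := by ring

/-- Cauchy–Schwarz in time; the number of steps times `τ` is at most `T`. -/
lemma sq_sum_avg_le (f : ℕ → ℝ) {n : ℕ} (hτ : 0 < τ) (hn : n * τ ≤ T) :
    (τ * ∑ i ∈ range n, (f (i + 1) + f i) / 2) ^ 2 ≤ T * (τ * ∑ k ∈ range (n + 1), f k ^ 2) := by
  have h1 := sq_sum_le_card_mul_sum_sq (s := range n) (f := fun i => (f (i + 1) + f i) / 2)
  rw [Finset.card_range] at h1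
  have h2 : ∑ i ∈ range n, ((f (i + 1) + f i) / 2) ^ 2 ≤ ∑ k ∈ range (n + 1), f k ^ 2 := by
    have h3 : ∀ i ∈ range n, ((f (i + 1) + f i) / 2) ^ 2 ≤ f (i + 1) ^ 2 / 2 + f i ^ 2 / 2 :=
      fun i _ => by nlinarith [sq_nonneg (f (i + 1) - f i)]
    refine (Finset.sum_le_sum h3).trans ?_
    rw [Finset.sum_add_distrib, ← Finset.sum_div, ← Finset.sum_div]
    have h4 := Finset.sum_range_succ' (fun k => f k ^ 2) n
    have h5 := Finset.sum_range_succ (fun k => f k ^ 2) n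
    have h6 := sq_nonneg (f 0)
    have h7 := sq_nonneg (f n)
    linarith
  have h8 : 0 ≤ ∑ k ∈ range (n + 1), f k ^ 2 := by positivity
  calc _ = τ ^ 2 * (∑ i ∈ range n, (f (i + 1) + f i) / 2) ^ 2 := by ring
    _ ≤ τ ^ 2 * (n * ∑ k ∈ range (n + 1), f k ^ 2) := by
        gcongr
        exact h1.trans (by gcongr)
    _ = n * τ * (τ * ∑ k ∈ range (n + 1), f k ^ 2) := by ring
    _ ≤ _ := by gcongr

lemma sq_add_four_le {w G₁ G₂ G₃ S₁ S₂ S₃ : ℝ} (h₁ : 0 ≤ S₁) (h₂ : 0 ≤ S₂) (h₃ : 0 ≤ S₃)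
    (g₁ : G₁ ^ 2 ≤ m₁ * S₁) (g₂ : G₂ ^ 2 ≤ m₂ * S₂) (g₃ : G₃ ^ 2 ≤ m₃ * S₃) :
    (w + G₁ + G₂ + G₃) ^ 2 ≤ 4 * ((1 + m₁ + m₂ + m₃) * (w ^ 2 + S₁ + S₂ + S₃)) := by
  have g4 : (w + G₁ + G₂ + G₃) ^ 2 ≤ 4 * (w ^ 2 + G₁ ^ 2 + G₂ ^ 2 + G₃ ^ 2) := by
    linarith [sq_nonneg (w - G₁), sq_nonneg (w - G₂), sq_nonneg (w - G₃),
      sq_nonneg (G₁ - G₂), sq_nonneg (G₁ - G₃), sq_nonneg (G₂ - G₃)]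
  have g5 : 0 ≤ (m₁ + m₂ + m₃) * w ^ 2 + (1 + m₂ + m₃) * S₁ + (1 + m₁ + m₃) * S₂
      + (1 + m₁ + m₂) * S₃ := by positivity
  linarith

/-- With `R = Φ + T c G`, Young's inequality `2sR ≤ s²/2 + 2R²` absorbs half of `M = s²` and leaves
`M ≤ 2u₀ + 4R²`. The constants follow from `R² ≤ 2Φ² + 2(TcG)²` and from the factor 2 in passing
from `v^n - v^0` to `v^n`. -/
lemma energy_combine {v₀ v d u₀ u w S SF Φ G c M s k : ℝ} (hT : 0 ≤ T) (hk : 0 ≤ k)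
    (hv₀ : 0 ≤ v₀) (hu₀ : 0 ≤ u₀) (hu : 0 ≤ u) (hw : 0 ≤ w) (hS : 0 ≤ S) (hSF : 0 ≤ SF)
    (hs : s ^ 2 = M) (hM : M ≤ u₀ + s * (2 * (Φ + T * (c * G))))
    (hΦ : Φ ^ 2 ≤ T * SF) (hG : G ^ 2 ≤ 4 * (k * (w + S)))
    (hv : v ≤ 2 * v₀ + 2 * d) (hd : d + u ≤ M) :
    v + u ≤ (4 + 16 * T + 64 * T ^ 2 * c ^ 2 * k) * (v₀ + u₀ + w + S + SF) := by
  have hM2 : M ≤ 2 * u₀ + 4 * (Φ + T * (c * G)) ^ 2 := by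
    linarith [sq_nonneg (s - 2 * (Φ + T * (c * G)))]
  have h1 : T ^ 2 * c ^ 2 * G ^ 2 ≤ T ^ 2 * c ^ 2 * (4 * (k * (w + S))) := by gcongr
  have hQ : (Φ + T * (c * G)) ^ 2 ≤ 2 * (T * SF) + 2 * (T ^ 2 * c ^ 2 * (4 * (k * (w + S)))) := by
    linarith [sq_nonneg (Φ - T * (c * G))]
  have q1 : 0 ≤ (2 + 16 * T + 64 * T ^ 2 * c ^ 2 * k) * v₀ := by positivity
  have q2 : 0 ≤ (16 * T + 64 * T ^ 2 * c ^ 2 * k) * u₀ := by positivity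
  have q3 : 0 ≤ (4 + 64 * T ^ 2 * c ^ 2 * k) * SF := by positivity
  have q4 : 0 ≤ (4 + 16 * T) * (w + S) := by positivity
  linarith

/-- Stability of the tested scheme. -/
theorem TestedScheme.stability {Cu Cv Cw : ℝ}
    (h : TestedScheme α ν μ τ nT m₁ m₂ m₃ uw vw ww V U W F)
    (hα : 0 < α) (hα1 : α ≤ 1) (hν : 0 ≤ ν) (hμ : 0 < μ)
    (hτ : 0 < τ) (hτT : nT * τ = T) (hCu : 0 ≤ Cu) (hCv : 0 ≤ Cv) (hCw : 0 ≤ Cw)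
    (hu : ∀ n, ∀ k ∈ Icc 1 m₁, |uw n k| ≤ Cu) (hv : ∀ n, ∀ k ∈ Icc 1 m₂, |vw n k| ≤ Cv)
    (hw0 : ∀ k ∈ Icc 1 m₃, |ww 0 k| ≤ Cw)
    (hw : ∀ n : ℕ, 1 ≤ n → ∀ k ∈ Icc 1 m₃, |ww n k| ≤ Cw * (n : ℝ) ^ (1 - α))
    {n : ℕ} (hn : n ≤ nT) :
    ‖V n‖ ^ 2 + μ * ‖U n‖ ^ 2 ≤
      (4 + 16 * T + 64 * T ^ 2 * dataBound T α ν μ Cu Cv Cw m₁ m₂ m₃ ^ 2 * (1 + m₁ + m₂ + m₃)) *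
      (‖V 0‖ ^ 2 + μ * ‖U 0‖ ^ 2 + ‖W 0‖ ^ 2
        + ∑ r ∈ Icc 1 m₁, ‖τ⁻¹ • (U r - U (r - 1))‖ ^ 2
        + ∑ r ∈ Icc 1 m₂, ‖τ⁻¹ • (V r - V (r - 1))‖ ^ 2
        + ∑ r ∈ Icc 1 m₃, ‖τ⁻¹ • (V r - V (r - 1))‖ ^ 2
        + τ * ∑ k ∈ range (n + 1), ‖F k‖ ^ 2) := by
  set c := dataBound T α ν μ Cu Cv Cw m₁ m₂ m₃ with hc
  set G₁ := ∑ r ∈ Icc 1 m₁, ‖τ⁻¹ • (U r - U (r - 1))‖ with hG₁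
  set G₂ := ∑ r ∈ Icc 1 m₂, ‖τ⁻¹ • (V r - V (r - 1))‖ with hG₂
  set G₃ := ∑ r ∈ Icc 1 m₃, ‖τ⁻¹ • (V r - V (r - 1))‖ with hG₃
  set G := ‖W 0‖ + G₁ + G₂ + G₃ with hG
  let e : ℕ → ℝ := fun k => ‖V k - V 0‖ ^ 2 + μ * ‖U k‖ ^ 2
  have he0 : ∀ k, 0 ≤ e k := fun k => by positivity
  have hT0 : 0 ≤ T := by rw [← hτT]; positivity
  have hc0 : 0 ≤ c := by rw [hc]; unfold dataBound; positivity
  -- `√M` bounds all factors up to level `n` at once; summing the steps up to the maximizing level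
  -- `j` puts `M` itself on the left.
  obtain ⟨j, hj, hjmax⟩ := Finset.exists_max_image (range (n + 1)) e ⟨0, by simp⟩
  set M := e j with hM
  set s := √M with hs
  have hs0 : 0 ≤ s := Real.sqrt_nonneg _
  have hs2 : s ^ 2 = M := Real.sq_sqrt (he0 j)
  have hVs : ∀ k ≤ n, ‖V k - V 0‖ ≤ s := by
    intro k hk
    have h1 := hjmax k (Finset.mem_range.2 (by omega))
    refine Real.le_sqrt_of_sq_le (le_trans ?_ h1)
    have : 0 ≤ μ * ‖U k‖ ^ 2 := by positivity
    simp only [e]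
    linarith
  have hUs : ∀ k ≤ n, √μ * ‖U k‖ ≤ s := by
    intro k hk
    have h1 := hjmax k (Finset.mem_range.2 (by omega))
    refine Real.le_sqrt_of_sq_le (le_trans ?_ h1)
    rw [mul_pow, Real.sq_sqrt hμ.le]
    have : 0 ≤ ‖V k - V 0‖ ^ 2 := by positivity
    simp only [e]
    linarith
  let y : ℕ → E := fun k => (2⁻¹ : ℝ) • (V (k + 1) + V k) - V 0
  let φ : ℕ → ℝ := fun k => (‖F (k + 1)‖ + ‖F k‖) / 2
  have hstep : ∀ m ≤ n, e m + 2 * τ * ν * (τ ^ α)⁻¹ *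
      ∑ i ∈ range m, inner ℝ (∑ k ∈ range (i + 1), gWeight α (i - k) • y k) (y i)
      ≤ e 0 + ∑ i ∈ range m, 2 * τ * s * (φ i + c * G) := by
    intro m
    induction m with
    | zero => simp
    | succ m ih =>
      intro hm
      have h1 := ih (by omega)
      have h2 := h.energy_step hα1 hν hμ hτ hτT hCu hCv hCw hu hv hw0 hw (n := m) (by omega) hs0
        (fun k hk => hVs k (by have := (Finset.mem_Icc.1 hk).2; omega))
        (fun k hk => hUs k (by have := (Finset.mem_Icc.1 hk).2; omega)) (y := y) (fun k => rfl)
      rw [Finset.sum_range_succ (fun i =>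
          inner ℝ (∑ k ∈ range (i + 1), gWeight α (i - k) • y k) (y i)),
        Finset.sum_range_succ (fun i => 2 * τ * s * (φ i + c * G)), mul_add]
      simp only [e, φ] at h1 h2 ⊢
      linarith
  have hjn : j ≤ n := Nat.lt_succ_iff.1 (Finset.mem_range.1 hj)
  have hnτ : n * τ ≤ T := by
    rw [← hτT]
    have : (n : ℝ) ≤ nT := by exact_mod_cast hn
    gcongr
  set Φ := τ * ∑ i ∈ range n, φ i with hΦ
  have hφ0 : ∀ i, 0 ≤ φ i := fun i => by positivity
  have hG0 : 0 ≤ G := by positivity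
  have hMle : M ≤ e 0 + s * (2 * (Φ + T * (c * G))) := by
    have h1 := hstep j hjn
    have h2 := sum_inner_gWeight_nonneg hα hα1 y j
    have h3 : 0 ≤ 2 * τ * ν * (τ ^ α)⁻¹ *
      ∑ i ∈ range j, inner ℝ (∑ k ∈ range (i + 1), gWeight α (i - k) • y k) (y i) :=
      mul_nonneg (by positivity) h2
    have h4 : ∑ i ∈ range j, 2 * τ * s * (φ i + c * G)
        ≤ ∑ i ∈ range n, 2 * τ * s * (φ i + c * G) :=
      Finset.sum_le_sum_of_subset_of_nonneg (Finset.range_mono hjn)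
        fun i _ _ => by have := hφ0 i; positivity
    have h5 : ∑ i ∈ range n, 2 * τ * s * (φ i + c * G) = s * (2 * (Φ + n * τ * (c * G))) := by
      rw [← Finset.mul_sum, Finset.sum_add_distrib, hΦ]
      simp
      ring
    have h6 : s * (2 * (Φ + n * τ * (c * G))) ≤ s * (2 * (Φ + T * (c * G))) := by gcongr
    linarith
  have hVn : ‖V n‖ ^ 2 ≤ 2 * ‖V 0‖ ^ 2 + 2 * ‖V n - V 0‖ ^ 2 := by
    have h1 : ‖V n‖ ≤ ‖V n - V 0‖ + ‖V 0‖ := by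
      simpa using norm_add_le (V n - V 0) (V 0)
    nlinarith [sq_nonneg (‖V n - V 0‖ - ‖V 0‖), norm_nonneg (V n)]
  have hG2 := sq_add_four_le (w := ‖W 0‖)
    (Finset.sum_nonneg fun r _ => sq_nonneg ‖τ⁻¹ • (U r - U (r - 1))‖)
    (Finset.sum_nonneg fun r _ => sq_nonneg ‖τ⁻¹ • (V r - V (r - 1))‖)
    (Finset.sum_nonneg fun r _ => sq_nonneg ‖τ⁻¹ • (V r - V (r - 1))‖)
    (sq_sum_Icc_le (fun r => ‖τ⁻¹ • (U r - U (r - 1))‖) m₁)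
    (sq_sum_Icc_le (fun r => ‖τ⁻¹ • (V r - V (r - 1))‖) m₂)
    (sq_sum_Icc_le (fun r => ‖τ⁻¹ • (V r - V (r - 1))‖) m₃)
  rw [add_assoc (‖W 0‖ ^ 2), add_assoc (‖W 0‖ ^ 2)] at hG2
  have he0' : e 0 = μ * ‖U 0‖ ^ 2 := by simp [e]
  rw [he0'] at hMle
  refine (energy_combine hT0 (by positivity) (sq_nonneg ‖V 0‖) (by positivity) (by positivity)
    (sq_nonneg ‖W 0‖) (by positivity) (by positivity) hs2 hMle
    (sq_sum_avg_le (fun k => ‖F k‖) hτ hnτ) hG2 hVn (hjmax n (by simp))).trans (le_of_eq ?_)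
  ring

end Energy

/-! ### Piecewise polynomial functions -/

section PiecewisePoly

open MeasureTheory

variable {a b : ℝ}

/-- Functions that agree with a polynomial inside each element of the mesh. -/
def piecewisePoly (mesh : Mesh a b) : Submodule ℝ (ℝ → ℝ) where
  carrier := {h | ∀ i : Fin mesh.M, ∃ p : Polynomial ℝ,
    ∀ x ∈ Set.Ioo (mesh.pt i.castSucc) (mesh.pt i.succ), h x = p.eval x}
  add_mem' := fun {f g} hf hg i => by
    obtain ⟨p, hp⟩ := hf i
    obtain ⟨q, hq⟩ := hg i
    exact ⟨p + q, fun x hx => by simp [hp x hx, hq x hx]⟩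
  zero_mem' := fun i => ⟨0, fun x _ => by simp⟩
  smul_mem' := fun c f hf i => by
    obtain ⟨p, hp⟩ := hf i
    exact ⟨Polynomial.C c * p, fun x hx => by simp [hp x hx]⟩

variable {mesh : Mesh a b}

lemma Mesh.exists_mem_Ioo (mesh : Mesh a b) {x : ℝ} (hx : x ∈ Set.Ioc a b)
    (hx' : x ∉ Set.range mesh.pt) :
    ∃ i : Fin mesh.M, x ∈ Set.Ioo (mesh.pt i.castSucc) (mesh.pt i.succ) := by
  have key : ∀ (k : ℕ) (hk : k < mesh.M + 1), x < mesh.pt ⟨k, hk⟩ →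
      ∃ i : Fin mesh.M, x ∈ Set.Ioo (mesh.pt i.castSucc) (mesh.pt i.succ) := by
    intro k
    induction k with
    | zero =>
      intro hk h
      have h0 : mesh.pt ⟨0, hk⟩ = a := mesh.pt_first
      rw [h0] at h
      exact absurd hx.1 (not_lt.2 h.le)
    | succ k ih =>
      intro hk h
      rcases lt_or_ge x (mesh.pt ⟨k, by omega⟩) with h1 | h1
      · exact ih _ h1
      · exact ⟨⟨k, by omega⟩, lt_of_le_of_ne h1 fun h2 => hx' ⟨_, h2⟩, h⟩
  refine key mesh.M (by omega) ?_
  have hb : mesh.pt ⟨mesh.M, by omega⟩ = b := mesh.pt_last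
  rw [hb]
  exact lt_of_le_of_ne hx.2 fun h => hx' ⟨_, mesh.pt_last.trans h.symm⟩

lemma Mesh.ae_mem_Ioo (mesh : Mesh a b) :
    ∀ᵐ x ∂(volume.restrict (Set.Ioc a b)), ∃ i : Fin mesh.M,
      x ∈ Set.Ioo (mesh.pt i.castSucc) (mesh.pt i.succ) := by
  rw [ae_restrict_iff' measurableSet_Ioc]
  filter_upwards [(Set.finite_range mesh.pt).countable.ae_notMem volume] with x hx hx'
  exact mesh.exists_mem_Ioo hx' hx

lemma integrableOn_of_mem_piecewisePoly {h : ℝ → ℝ} (hh : h ∈ piecewisePoly mesh) :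
    IntegrableOn h (Set.Ioc a b) := by
  have h1 : IntegrableOn h
      (⋃ i : Fin mesh.M, Set.Ioo (mesh.pt i.castSucc) (mesh.pt i.succ)) := by
    rw [integrableOn_finite_iUnion]
    intro i
    obtain ⟨p, hp⟩ := hh i
    exact (p.continuous.integrableOn_Icc.mono_set Set.Ioo_subset_Icc_self).congr_fun
      (fun x hx => (hp x hx).symm) measurableSet_Ioo
  refine h1.mono_set_ae ?_
  have h2 := mesh.ae_mem_Ioo
  rw [ae_restrict_iff' measurableSet_Ioc] at h2
  filter_upwards [h2] with x hx hx'
  exact Set.mem_iUnion.2 (hx hx')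

lemma memLp_of_mem_piecewisePoly {h : ℝ → ℝ} (hh : h ∈ piecewisePoly mesh) :
    MemLp h 2 (volume.restrict (Set.Ioc a b)) := by
  rw [memLp_two_iff_integrable_sq (integrableOn_of_mem_piecewisePoly hh).aestronglyMeasurable]
  refine integrableOn_of_mem_piecewisePoly (mesh := mesh) fun i => ?_
  obtain ⟨p, hp⟩ := hh i
  exact ⟨p ^ 2, fun x hx => by simp [hp x hx]⟩

/-- The inclusion of the piecewise polynomial functions into `L²(a, b)`. -/
def toL2 (mesh : Mesh a b) :
    piecewisePoly mesh →ₗ[ℝ] Lp ℝ 2 (volume.restrict (Set.Ioc a b)) where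
  toFun h := (memLp_of_mem_piecewisePoly h.2).toLp h
  map_add' _ _ := rfl
  map_smul' _ _ := rfl

/-- Values at the mesh points are immaterial. This is needed for `derivL2`: `deriv` is linear inside
the elements, but not necessarily at the nodes. -/
lemma toL2_congr {g h : piecewisePoly mesh}
    (hgh : ∀ i : Fin mesh.M, ∀ x ∈ Set.Ioo (mesh.pt i.castSucc) (mesh.pt i.succ),
      (g : ℝ → ℝ) x = (h : ℝ → ℝ) x) : toL2 mesh g = toL2 mesh h := by
  refine (MemLp.toLp_eq_toLp_iff (memLp_of_mem_piecewisePoly g.2)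
    (memLp_of_mem_piecewisePoly h.2)).2 ?_
  filter_upwards [mesh.ae_mem_Ioo] with x ⟨i, hx⟩
  exact hgh i x hx

lemma inner_toL2 (hab : a ≤ b) (g h : piecewisePoly mesh) :
    inner ℝ (toL2 mesh g) (toL2 mesh h) = ip a b g h := by
  rw [L2.inner_def, ip, intervalIntegral.integral_of_le hab]
  refine integral_congr_ae ?_
  filter_upwards [(memLp_of_mem_piecewisePoly g.2).coeFn_toLp,
    (memLp_of_mem_piecewisePoly h.2).coeFn_toLp] with x hg hh
  change inner ℝ (MemLp.toLp (g : ℝ → ℝ) (memLp_of_mem_piecewisePoly g.2) x)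
    (MemLp.toLp (h : ℝ → ℝ) (memLp_of_mem_piecewisePoly h.2) x) = _
  rw [hg, hh]
  simp [mul_comm]

lemma norm_toL2 (hab : a ≤ b) (h : piecewisePoly mesh) : ‖toL2 mesh h‖ = l2norm a b h := by
  rw [norm_eq_sqrt_real_inner, inner_toL2 hab, l2norm, ip]
  congr 1
  refine intervalIntegral.integral_congr fun x _ => ?_
  simp [sq]

lemma differentiableAt_of_mem_piecewisePoly {h : ℝ → ℝ} (hh : h ∈ piecewisePoly mesh)
    {i : Fin mesh.M} {x : ℝ} (hx : x ∈ Set.Ioo (mesh.pt i.castSucc) (mesh.pt i.succ)) :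
    DifferentiableAt ℝ h x := by
  obtain ⟨p, hp⟩ := hh i
  refine p.differentiableAt.congr_of_eventuallyEq ?_
  filter_upwards [isOpen_Ioo.mem_nhds hx] with y hy
  exact hp y hy

lemma deriv_mem_piecewisePoly {h : ℝ → ℝ} (hh : h ∈ piecewisePoly mesh) :
    deriv h ∈ piecewisePoly mesh := by
  intro i
  obtain ⟨p, hp⟩ := hh i
  refine ⟨p.derivative, fun x hx => ?_⟩
  have : h =ᶠ[𝓝 x] fun y => p.eval y := by
    filter_upwards [isOpen_Ioo.mem_nhds hx] with y hy
    exact hp y hy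
  rw [this.deriv_eq, Polynomial.deriv]

/-- The derivative of a piecewise polynomial function as an element of `L²(a, b)`. -/
def derivL2 (mesh : Mesh a b) :
    piecewisePoly mesh →ₗ[ℝ] Lp ℝ 2 (volume.restrict (Set.Ioc a b)) where
  toFun h := toL2 mesh ⟨deriv h, deriv_mem_piecewisePoly h.2⟩
  map_add' g h := by
    rw [← map_add]
    refine toL2_congr fun i x hx => ?_
    exact deriv_add (differentiableAt_of_mem_piecewisePoly g.2 hx)
      (differentiableAt_of_mem_piecewisePoly h.2 hx)
  map_smul' c h := by
    rw [RingHom.id_apply, ← map_smul]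
    refine toL2_congr fun i x hx => ?_
    exact deriv_const_smul c (differentiableAt_of_mem_piecewisePoly h.2 hx)

lemma inner_derivL2 (hab : a ≤ b) (g h : piecewisePoly mesh) :
    inner ℝ (derivL2 mesh g) (derivL2 mesh h) = ip a b (deriv g) (deriv h) :=
  inner_toL2 hab _ _

lemma norm_derivL2 (hab : a ≤ b) (h : piecewisePoly mesh) :
    ‖derivL2 mesh h‖ = l2norm a b (deriv h) :=
  norm_toL2 hab _

lemma VN0_subset_piecewisePoly {h : ℝ → ℝ} (hh : h ∈ VN0 mesh) : h ∈ piecewisePoly mesh :=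
  fun i => (hh.1.2 i).imp fun _ hp => hp.2

/-! ### The discrete space and the interpolation operator -/

lemma intervalIntegrable_of_memLp {g : ℝ → ℝ} (hg : MemLp g 2 (volume.restrict (Set.Ioo a b)))
    {x : ℝ} (hx : x ∈ Set.Icc a b) : IntervalIntegrable g volume a x := by
  rw [intervalIntegrable_iff_integrableOn_Ioo_of_le hx.1]
  exact IntegrableOn.mono_set (hg.integrable (by norm_num)) (Set.Ioo_subset_Ioo_right hx.2)

lemma H10_add {f g : ℝ → ℝ} (hf : f ∈ H10 a b) (hg : g ∈ H10 a b) : f + g ∈ H10 a b := by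
  obtain ⟨f', hf', hf, hfb⟩ := hf
  obtain ⟨g', hg', hg, hgb⟩ := hg
  refine ⟨f' + g', hf'.add hg', fun x hx => ?_, by simp [hfb, hgb]⟩
  simp only [Pi.add_apply]
  rw [intervalIntegral.integral_add (intervalIntegrable_of_memLp hf' hx)
    (intervalIntegrable_of_memLp hg' hx), hf x hx, hg x hx]

lemma H10_smul (c : ℝ) {f : ℝ → ℝ} (hf : f ∈ H10 a b) : c • f ∈ H10 a b := by
  obtain ⟨f', hf', hf, hfb⟩ := hf
  refine ⟨c • f', hf'.const_smul c, fun x hx => ?_, by simp [hfb]⟩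
  simp only [Pi.smul_apply, smul_eq_mul, intervalIntegral.integral_const_mul]
  rw [hf x hx]

lemma zero_mem_H10 : (0 : ℝ → ℝ) ∈ H10 a b :=
  ⟨0, MemLp.zero', fun x _ => by simp, rfl⟩

/-- `VN0` as a submodule. -/
def VN0Submodule (mesh : Mesh a b) : Submodule ℝ (ℝ → ℝ) where
  carrier := VN0 mesh
  add_mem' := fun {f g} hf hg => ⟨⟨hf.1.1.add hg.1.1, fun i => by
    obtain ⟨p, hp, hp'⟩ := hf.1.2 i
    obtain ⟨q, hq, hq'⟩ := hg.1.2 i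
    exact ⟨p + q, Polynomial.natDegree_add_le_of_degree_le hp hq,
      fun x hx => by simp [hp' x hx, hq' x hx]⟩⟩, H10_add hf.2 hg.2⟩
  zero_mem' := ⟨⟨continuousOn_const, fun i => ⟨0, by simp, fun x _ => by simp⟩⟩, zero_mem_H10⟩
  smul_mem' := fun c f hf => ⟨⟨hf.1.1.const_smul c, fun i => by
    obtain ⟨p, hp, hp'⟩ := hf.1.2 i
    exact ⟨Polynomial.C c * p, (Polynomial.natDegree_C_mul_le c p).trans hp,
      fun x hx => by simp [hp' x hx]⟩⟩, H10_smul c hf.2⟩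

lemma interp_mem_piecewisePoly (mesh : Mesh a b) (u : ℝ → ℝ) :
    interp mesh u ∈ piecewisePoly mesh := by
  intro i
  refine ⟨localInterp mesh u i, fun x hx => ?_⟩
  have hax : x ≠ a := by
    have h0 : a ≤ mesh.pt i.castSucc := by
      have := mesh.strictMono.monotone (Fin.zero_le i.castSucc)
      rwa [mesh.pt_first] at this
    exact (h0.trans_lt hx.1).ne'
  unfold interp
  rw [Set.indicator_of_notMem (by simpa using hax), zero_add, Finset.sum_eq_single i]
  · rw [Set.indicator_of_mem (Set.Ioo_subset_Ioc_self hx)]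
  · intro j _ hji
    refine Set.indicator_of_notMem (fun hxj => ?_) _
    rcases lt_or_gt_of_ne hji with h | h
    · have := mesh.strictMono.monotone (Fin.succ_le_castSucc_iff.2 h)
      exact absurd (hxj.2.trans this) (not_le.2 hx.1)
    · have := mesh.strictMono.monotone (Fin.succ_le_castSucc_iff.2 h)
      exact absurd (hx.2.le.trans this) (not_le.2 hxj.1)
  · simp

lemma interp_avg (mesh : Mesh a b) (F : ℕ → ℝ → ℝ) (n : ℕ) :
    interp mesh (avg F n) = (2⁻¹ : ℝ) • (interp mesh (F (n + 1)) + interp mesh (F n)) := by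
  have hl : ∀ i, localInterp mesh (avg F n) i
      = (2⁻¹ : ℝ) • (localInterp mesh (F (n + 1)) i + localInterp mesh (F n) i) := by
    intro i
    have : avg F n = (2⁻¹ : ℝ) • (F (n + 1) + F n) := by
      funext x
      simp [avg]
      ring
    unfold localInterp
    rw [this, map_smul, map_add]
  funext x
  simp only [interp, hl, Pi.smul_apply, Pi.add_apply, smul_eq_mul]
  have h1 : Set.indicator {a} (avg F n) x
      = 2⁻¹ * (Set.indicator {a} (F (n + 1)) x + Set.indicator {a} (F n) x) := by
    by_cases hx : x ∈ ({a} : Set ℝ)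
    · simp only [Set.indicator_of_mem hx, avg]
      ring
    · simp [Set.indicator_of_notMem hx]
  rw [h1, add_add_add_comm, ← Finset.sum_add_distrib, mul_add (2⁻¹ : ℝ) (_ + _) (∑ _, _),
    Finset.mul_sum]
  congr 1
  refine Finset.sum_congr rfl fun i _ => ?_
  by_cases hx : x ∈ Set.Ioc (mesh.pt i.castSucc) (mesh.pt i.succ)
  · simp only [Set.indicator_of_mem hx]
    simp
    ring
  · simp only [Set.indicator_of_notMem hx]
    simp

/-! ### From the scheme to its tested form -/

/-- A sequence with members in `VN0` up to `nT`, as piecewise polynomial functions. -/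
def truncSeq (mesh : Mesh a b) (nT : ℕ) (v : ℕ → ℝ → ℝ) (hv : ∀ n ≤ nT, v n ∈ VN0 mesh) (n : ℕ) :
    piecewisePoly mesh :=
  if h : n ≤ nT then ⟨v n, VN0_subset_piecewisePoly (hv n h)⟩ else 0

variable {nT : ℕ} {u v : ℕ → ℝ → ℝ}

lemma coe_truncSeq {hv : ∀ n ≤ nT, v n ∈ VN0 mesh} {n : ℕ} (hn : n ≤ nT) :
    (truncSeq mesh nT v hv n : ℝ → ℝ) = v n := by
  rw [truncSeq, dif_pos hn]

lemma coe_diffQ {hv : ∀ n ≤ nT, v n ∈ VN0 mesh} (τ : ℝ) {n : ℕ} (hn : n < nT) :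
    ((τ⁻¹ • (truncSeq mesh nT v hv (n + 1) - truncSeq mesh nT v hv n) : piecewisePoly mesh) :
      ℝ → ℝ) = diffQ τ v n := by
  funext x
  simp [coe_truncSeq (hv := hv) (show n + 1 ≤ nT from hn), coe_truncSeq (hv := hv) hn.le, diffQ]
  ring

lemma coe_avg {hv : ∀ n ≤ nT, v n ∈ VN0 mesh} {n : ℕ} (hn : n < nT) :
    (((2⁻¹ : ℝ) • (truncSeq mesh nT v hv (n + 1) + truncSeq mesh nT v hv n) :
      piecewisePoly mesh) : ℝ → ℝ) = avg v n := by
  funext x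
  simp [coe_truncSeq (hv := hv) (show n + 1 ≤ nT from hn), coe_truncSeq (hv := hv) hn.le, avg]
  ring

lemma coe_sub_zero {hv : ∀ n ≤ nT, v n ∈ VN0 mesh} {n : ℕ} (hn : n ≤ nT) :
    ((truncSeq mesh nT v hv n - truncSeq mesh nT v hv 0 : piecewisePoly mesh) : ℝ → ℝ)
      = fun x => v n x - v 0 x := by
  funext x
  simp [coe_truncSeq (hv := hv) hn, coe_truncSeq (hv := hv) (Nat.zero_le nT)]

lemma coe_corrWSGL {hv : ∀ n ≤ nT, v n ∈ VN0 mesh} (α τ : ℝ) (w : ℕ → ℕ → ℝ) {m n : ℕ}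
    (hm : m ≤ nT) (hn : n ≤ nT) :
    (((τ ^ α)⁻¹ • (∑ k ∈ range (n + 1), gWeight α (n - k) •
        (truncSeq mesh nT v hv k - truncSeq mesh nT v hv 0)
      + ∑ k ∈ Icc 1 m, w n k • (truncSeq mesh nT v hv k - truncSeq mesh nT v hv 0)) :
      piecewisePoly mesh) : ℝ → ℝ) = corrWSGL α τ w m n (fun k x => v k x - v 0 x) := by
  have h1 : ∀ k ∈ range (n + 1), ((gWeight α (n - k) •
      (truncSeq mesh nT v hv k - truncSeq mesh nT v hv 0) : piecewisePoly mesh) : ℝ → ℝ)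
      = gWeight α (n - k) • fun x => v k x - v 0 x := fun k hk => by
    rw [Submodule.coe_smul, coe_sub_zero ((Nat.lt_succ_iff.1 (Finset.mem_range.1 hk)).trans hn)]
  have h2 : ∀ k ∈ Icc 1 m, ((w n k •
      (truncSeq mesh nT v hv k - truncSeq mesh nT v hv 0) : piecewisePoly mesh) : ℝ → ℝ)
      = w n k • fun x => v k x - v 0 x := fun k hk => by
    rw [Submodule.coe_smul, coe_sub_zero ((Finset.mem_Icc.1 hk).2.trans hm)]
  rw [Submodule.coe_smul, Submodule.coe_add, Submodule.coe_sum, Submodule.coe_sum,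
    Finset.sum_congr rfl h1, Finset.sum_congr rfl h2]
  funext x
  simp [corrWSGL, Finset.sum_apply]
  ring

/-- The test functions must lie in `VN0`, whereas the energy argument takes place in `L²`. All
indices that occur are at most `nT`, those of the corrections because `mᵢ ≤ nT`, so the zero tail of
`truncSeq` is never seen. -/
theorem IsSchemeSolution.testedScheme {α ν μ τ : ℝ} {m₁ m₂ m₃ : ℕ} {uw vw ww : ℕ → ℕ → ℝ}
    {f : ℝ → ℝ → ℝ} {φ₀ ψ₀ : ℝ → ℝ} (hab : a ≤ b) (hm₁ : m₁ ≤ nT) (hm₂ : m₂ ≤ nT) (hm₃ : m₃ ≤ nT)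
    (h : IsSchemeSolution mesh α ν μ τ nT m₁ m₂ m₃ uw vw ww f φ₀ ψ₀ u v) :
    TestedScheme α ν μ τ nT m₁ m₂ m₃ uw vw ww
      (fun n => toL2 mesh (truncSeq mesh nT v h.mem_v n))
      (fun n => derivL2 mesh (truncSeq mesh nT u h.mem_u n))
      (fun n => derivL2 mesh (truncSeq mesh nT v h.mem_v n))
      (fun n => toL2 mesh ⟨interp mesh (fun x => f x (n * τ)), interp_mem_piecewisePoly mesh _⟩)
      where
  eq_v := by
    intro n hn
    set vb := truncSeq mesh nT v h.mem_v with hvb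
    set ub := truncSeq mesh nT u h.mem_u with hub
    set w : piecewisePoly mesh := (2⁻¹ : ℝ) • (vb (n + 1) + vb n) - vb 0 with hw
    have hwc : (w : ℝ → ℝ) = (2⁻¹ : ℝ) • (v (n + 1) + v n) - v 0 := by
      rw [hw, Submodule.coe_sub, Submodule.coe_smul, Submodule.coe_add, coe_truncSeq hn,
        coe_truncSeq hn.le, coe_truncSeq (Nat.zero_le nT)]
    have hwV : (w : ℝ → ℝ) ∈ VN0 mesh := by
      rw [hwc]
      exact (VN0Submodule mesh).sub_mem ((VN0Submodule mesh).smul_mem _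
        ((VN0Submodule mesh).add_mem (h.mem_v _ hn) (h.mem_v _ hn.le))) (h.mem_v 0 (Nat.zero_le _))
    have key := h.eq_v n hn w hwV
    have hF : ((((2⁻¹ : ℝ) • (⟨interp mesh (fun x => f x ((n + 1 : ℕ) * τ)),
          interp_mem_piecewisePoly mesh _⟩
        + ⟨interp mesh (fun x => f x (n * τ)), interp_mem_piecewisePoly mesh _⟩) :
        piecewisePoly mesh)) : ℝ → ℝ) = interp mesh (avg (fun k x => f x (k * τ)) n) := by
      rw [interp_avg]
      rfl
    have hsum : ∑ r ∈ Icc 1 m₂, vw n r * ip a b (fun x => v r x - v 0 x) w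
        = ∑ r ∈ Icc 1 m₂, vw n r * inner ℝ (toL2 mesh (vb r - vb 0)) (toL2 mesh w) := by
      refine Finset.sum_congr rfl fun r hr => ?_
      rw [inner_toL2 hab, coe_sub_zero ((Finset.mem_Icc.1 hr).2.trans hm₂)]
    rw [hsum, ← coe_diffQ (hv := h.mem_v) τ hn, ← coe_avg (hv := h.mem_u) hn, ← hF,
      ← coe_corrWSGL (hv := h.mem_v) α τ ww hm₃ (show n + 1 ≤ nT from hn),
      ← coe_corrWSGL (hv := h.mem_v) α τ ww hm₃ hn.le, ← inner_toL2 hab, ← inner_toL2 hab,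
      ← inner_toL2 hab, ← inner_toL2 hab, ← inner_derivL2 hab, hw] at key
    simp only [map_smul, map_add, map_sub, map_sum, one_div] at key
    exact key
  eq_u := by
    intro n hn
    set vb := truncSeq mesh nT v h.mem_v with hvb
    set ub := truncSeq mesh nT u h.mem_u with hub
    set w : piecewisePoly mesh := (2⁻¹ : ℝ) • (ub (n + 1) + ub n) with hw
    have hwc : (w : ℝ → ℝ) = (2⁻¹ : ℝ) • (u (n + 1) + u n) := by
      rw [hw, Submodule.coe_smul, Submodule.coe_add, coe_truncSeq hn, coe_truncSeq hn.le]
    have hwV : (w : ℝ → ℝ) ∈ VN0 mesh := by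
      rw [hwc]
      exact (VN0Submodule mesh).smul_mem _
        ((VN0Submodule mesh).add_mem (h.mem_u _ hn) (h.mem_u _ hn.le))
    have key := h.eq_u n hn w hwV
    have hsum : ∑ r ∈ Icc 1 m₁, uw n r *
          ip a b (deriv (fun x => u r x - u 0 x - (r * τ) * v 0 x)) (deriv w)
        = ∑ r ∈ Icc 1 m₁, uw n r *
          inner ℝ (derivL2 mesh (ub r - ub 0 - ((r : ℝ) * τ) • vb 0)) (derivL2 mesh w) := by
      refine Finset.sum_congr rfl fun r hr => ?_
      have e : ((ub r - ub 0 - ((r : ℝ) * τ) • vb 0 : piecewisePoly mesh) : ℝ → ℝ)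
          = fun x => u r x - u 0 x - (r * τ) * v 0 x := by
        rw [Submodule.coe_sub, coe_sub_zero ((Finset.mem_Icc.1 hr).2.trans hm₁),
          Submodule.coe_smul, coe_truncSeq (Nat.zero_le nT)]
        rfl
      rw [inner_derivL2 hab, e]
    rw [hsum, ← coe_diffQ (hv := h.mem_u) τ hn, ← coe_avg (hv := h.mem_v) hn,
      ← inner_derivL2 hab, ← inner_derivL2 hab, hw] at key
    simp only [map_smul, map_add, map_sub, one_div] at key
    exact key

end PiecewisePoly

end LGSEM

end

/-! ### The stability estimate for the spectral element scheme -/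

theorem mainTheorem6
    (a b T α ν μ : ℝ) (hab : a < b) (hT : 0 < T) (hα : 0 < α) (hα1 : α ≤ 1)
    (hν : 0 ≤ ν) (hμ : 0 < μ)
    (σ : ℕ → ℝ) (hσ : ∀ r, 1 ≤ r → 1 < σ r ∧ σ r < σ (r + 1))
    (m₁ m₂ m₃ : ℕ)
    (hm₁ : 1 ≤ m₁ → σ m₁ ≤ 3) (hm₂ : 1 ≤ m₂ → σ m₂ ≤ 4) (hm₃ : 1 ≤ m₃ → σ m₃ ≤ 4)
    (uw vw ww : ℕ → ℕ → ℝ)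
    (huw : LGSEM.IsStartingWeightU σ m₁ uw)
    (hvw : LGSEM.IsStartingWeightV σ m₂ vw)
    (hww : LGSEM.IsStartingWeightW α σ m₃ ww) :
    ∃ C : ℝ, 0 < C ∧
      ∀ (mesh : LGSEM.Mesh a b) (nT : ℕ) (τ : ℝ) (f : ℝ → ℝ → ℝ) (φ₀ ψ₀ : ℝ → ℝ)
        (u v : ℕ → ℝ → ℝ),
        1 ≤ nT → m₁ ≤ nT → m₂ ≤ nT → m₃ ≤ nT → τ = T / nT →
        (∀ t ∈ Set.Icc 0 T, ContinuousOn (fun x => f x t) (Set.Icc a b)) →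
        φ₀ ∈ LGSEM.H10 a b → ψ₀ ∈ LGSEM.H10 a b →
        LGSEM.IsSchemeSolution mesh α ν μ τ nT m₁ m₂ m₃ uw vw ww f φ₀ ψ₀ u v →
        ∀ n ≤ nT,
          LGSEM.l2norm a b (v n) ^ 2 + μ * LGSEM.l2norm a b (deriv (u n)) ^ 2 ≤
            C * (LGSEM.l2norm a b (v 0) ^ 2 + μ * LGSEM.l2norm a b (deriv (u 0)) ^ 2
              + LGSEM.l2norm a b (deriv (v 0)) ^ 2
              + ∑ r ∈ Finset.Icc 1 m₁,
                  LGSEM.l2norm a b (deriv (LGSEM.diffQ τ u (r - 1))) ^ 2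
              + ∑ r ∈ Finset.Icc 1 m₂, LGSEM.l2norm a b (LGSEM.diffQ τ v (r - 1)) ^ 2
              + ∑ r ∈ Finset.Icc 1 m₃, LGSEM.l2norm a b (LGSEM.diffQ τ v (r - 1)) ^ 2
              + τ * ∑ k ∈ Finset.range (n + 1),
                  LGSEM.l2norm a b (LGSEM.interp mesh (fun x => f x (k * τ))) ^ 2) := by
  obtain ⟨Cu, hCu, hu⟩ := huw.exists_bound hσ hm₁
  obtain ⟨Cv, hCv, hv⟩ := hvw.exists_bound hσ hm₂
  obtain ⟨Cw, hCw, hw0, hw⟩ := hww.exists_bound hα hα1 hσ hm₃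
  -- The constant involves the weights only through their bounds `Cu`, `Cv`, `Cw`, fixed before the
  -- mesh and the time step are introduced.
  refine ⟨4 + 16 * T + 64 * T ^ 2 * LGSEM.dataBound T α ν μ Cu Cv Cw m₁ m₂ m₃ ^ 2
      * (1 + m₁ + m₂ + m₃), by positivity, fun mesh nT τ f φ₀ ψ₀ u v hnT h₁ h₂ h₃ hτ _ _ _ hsol n hn => ?_⟩
  have hnT0 : (0 : ℝ) < nT := by exact_mod_cast hnT
  have hτ0 : 0 < τ := by rw [hτ]; positivity
  have hτT : nT * τ = T := by rw [hτ]; field_simp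
  have key := (hsol.testedScheme hab.le h₁ h₂ h₃).stability hα hα1 hν hμ hτ0 hτT hCu hCv hCw
    hu hv hw0 hw hn
  have hdv : ∀ m ≤ nT, ∀ r ∈ Finset.Icc 1 m,
      ‖τ⁻¹ • (LGSEM.toL2 mesh (LGSEM.truncSeq mesh nT v hsol.mem_v r)
      - LGSEM.toL2 mesh (LGSEM.truncSeq mesh nT v hsol.mem_v (r - 1)))‖ ^ 2
      = LGSEM.l2norm a b (LGSEM.diffQ τ v (r - 1)) ^ 2 := by
    intro m hm r hr
    rw [Finset.mem_Icc] at hr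
    obtain ⟨k, rfl⟩ : ∃ k, r = k + 1 := ⟨r - 1, by omega⟩
    rw [Nat.add_sub_cancel, ← map_sub, ← map_smul, LGSEM.norm_toL2 hab.le,
      LGSEM.coe_diffQ τ (by omega)]
  have hdu : ∀ r ∈ Finset.Icc 1 m₁,
      ‖τ⁻¹ • (LGSEM.derivL2 mesh (LGSEM.truncSeq mesh nT u hsol.mem_u r)
      - LGSEM.derivL2 mesh (LGSEM.truncSeq mesh nT u hsol.mem_u (r - 1)))‖ ^ 2
      = LGSEM.l2norm a b (deriv (LGSEM.diffQ τ u (r - 1))) ^ 2 := by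
    intro r hr
    rw [Finset.mem_Icc] at hr
    obtain ⟨k, rfl⟩ : ∃ k, r = k + 1 := ⟨r - 1, by omega⟩
    rw [Nat.add_sub_cancel, ← map_sub, ← map_smul, LGSEM.norm_derivL2 hab.le,
      LGSEM.coe_diffQ τ (by omega)]
  rw [Finset.sum_congr rfl hdu, Finset.sum_congr rfl (hdv m₂ h₂),
    Finset.sum_congr rfl (hdv m₃ h₃)] at key
  simp only [LGSEM.norm_toL2 hab.le, LGSEM.norm_derivL2 hab.le, LGSEM.coe_truncSeq hn,
    LGSEM.coe_truncSeq (Nat.zero_le nT)] at key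
  exact key
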